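/- Let $b\ge 2$ be an integer. In the infinite complete $b$-ary rooted ordered tree, the random $b$-ary recursive tree $T_n$ with $n$ nodes is grown as follows: $T_1$ consists of the root, and $T_{n+1}$ arises from $T_n$ by adding a node chosen uniformly among the external nodes of $T_n$ (the nodes outside $T_n$ whose parent is in $T_n$). Let $Z=(Z_1,\dots,Z_b)$ be a random vector with non-negative, identically distributed (possibly dependent) entries such that $\|Z\|$ is bounded almost surely. Attach to the nodes $u$ of the infinite tree independent copies $Z^{(u)}$ of $Z$, independent of $T_n$, and let $Z^{(u)}_i$ be the weight of the edge from $u$ to its $i$-th child. The distance of two nodes is the sum of the weights of the edges on the path joining them. Let the internal path length $P_n$ be the sum of the distances of all nodes of $T_n$ to the root, and let the Wiener index $W_n$ be the sum of the distances over all unordered pairs of nodes of $T_n$. Put $\mu=E[Z_1]$. Then $P_n$ and $W_n$ are integrable, and there is a constant $D>0$ such that, with $\alpha:=\log\left(\frac{b\mu}{4D(b-1)e}\right)$, for every fixed $t>0$ one has, as $n\to\infty$, $$P\big(|P_n-E[P_n]|>t\,E[P_n]\big)\le \exp\left(-\frac{b}{b-1}\,\frac{\mu}{D}\,t\log n\,\big(\log\log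 n+\log t+\alpha+o(1)\big)\right)$$ and $$P\big(|W_n-E[W_n]|>t\,E[W_n]\big)\le \exp\left(-\frac{b}{b-1}\,\frac{\mu}{D}\,t\log n\,\big(\log\log n+\log t+\alpha+o(1)\big)\right).$$ (If $\mu=0$, then $P_n=W_n=0$ almost surely, and the right-hand sides are read as $1$.) -/

import Mathlib

open MeasureTheory ProbabilityTheory Filter Topology

namespace RecTree

/-- Nodes of the infinite complete `b`-ary rooted ordered tree: the word of child indices read
along the path from the root. The root is `[]`, and `u ++ [i]` is the `i`-th child of `u`. -/
abbrev Node (b : ℕ) : Type := List (Fin b)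

/-- A finite tree, given by its set of (internal) nodes. The labels of the nodes (their order of
appearance) are not recorded, as neither the path length nor the Wiener index depends on them. -/
abbrev Tree (b : ℕ) : Type := Finset (Node b)

instance (b : ℕ) : MeasurableSpace (Tree b) := ⊤

/-- External nodes of `S`: the nodes outside `S` that are a child of a node of `S`; the only
external node of the empty tree is the root. -/
def external {b : ℕ} (S : Tree b) : Finset (Node b) :=
  (insert [] (S.biUnion fun u => Finset.univ.image fun i : Fin b => u ++ [i])) \ S

open Classical in
/-- One growth step: a uniformly chosen external node becomes internal. For `1 ≤ b` there always
is an external node, so that the second branch is never used. -/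
noncomputable def grow {b : ℕ} (S : Tree b) : PMF (Tree b) :=
  if h : (external S).Nonempty then (PMF.uniformOfFinset (external S) h).map fun v => insert v S
  else PMF.pure S

/-- Law of the random `b`-ary recursive tree with `n` internal nodes. -/
noncomputable def treeLaw (b : ℕ) : ℕ → PMF (Tree b)
  | 0 => PMF.pure ∅
  | n + 1 => (treeLaw b n).bind grow

/-- Weights attached to all nodes of the complete tree: `z u i` is the weight of the edge from `u`
to its `i`-th child. -/
abbrev Weights (b : ℕ) : Type := Node b → Fin b → ℝ

/-- Law of the random `b`-ary recursive tree of size `n` with edge weights distributed as `ν`: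
independent weight vectors with law `ν` at all nodes, independent of the tree. -/
noncomputable def weightedTreeLaw (b n : ℕ) (ν : Measure (Fin b → ℝ)) [IsProbabilityMeasure ν] :
    Measure (Tree b × Weights b) :=
  (treeLaw b n).toMeasure.prod (Measure.infinitePi fun _ : Node b => ν)

/-- Weight of the edge between the node `v` and its parent (`0` for the root). -/
def edgeWeight {b : ℕ} (z : Weights b) (v : Node b) : ℝ :=
  if h : v = [] then 0 else z v.dropLast (v.getLast h)

/-- Edges on the path from the root to `u`, each represented by its lower end point. -/
def rootPath {b : ℕ} (u : Node b) : Finset (Node b) :=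
  u.inits.toFinset.erase []

/-- Weighted distance of `u` and `v`: the sum of the weights of the edges of the path joining them,
which are the edges that lie on exactly one of the two paths to the root. -/
def wdist {b : ℕ} (z : Weights b) (u v : Node b) : ℝ :=
  ∑ w ∈ symmDiff (rootPath u) (rootPath v), edgeWeight z w

/-- Internal path length: the sum of the distances of all nodes to the root. -/
def pathLength {b : ℕ} (x : Tree b × Weights b) : ℝ :=
  ∑ u ∈ x.1, wdist x.2 [] u

/-- Wiener index: the sum of the distances over all unordered pairs of nodes. -/
noncomputable def wienerIndex {b : ℕ} (x : Tree b × Weights b) : ℝ :=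
  (∑ u ∈ x.1, ∑ v ∈ x.1, wdist x.2 u v) / 2

end RecTree

namespace RecTree

/-! Both functionals are sums over edges of the edge weight times a toll depending on the number `k`
of nodes below the edge: the toll is `k` for the path length and `n * k - k ^ 2` for the Wiener
index of a tree with `n` nodes. For fixed `n` both belong to the family `quad p q`, which is stable
under scaling, so one exponential moment bound at parameter 1 covers all Chernoff parameters. Given
the tree, the exponential moment factors over nodes (`integral_exp_wtoll`). Cutting at the root
leaves branches that are independent given their sizes, and these sizes follow an urn
(`treeAvg_branches`). By induction the centred exponential moment is at most `exp (A * σ ^ 2 * exp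
(2 * C * σ))`, where `σ` is the scale of the toll (`exists_treeAvg_treeMgf_le`). Two facts drive the
induction. The root contribution, centred by the mean recursion, is `O(σ)`, because the leading `n
log n` terms of the mean cancel up to `O(n)` when a tree is split into its branches. And the squared
relative branch sizes sum to less than one by an amount, the `spread`, that is rarely small; this
gain pays for the root contribution (`urnAvg_mul_exp_neg_spread_le_one`). The mean exceeds the scale
by a factor of order `log n`. A Chernoff parameter `s` with `s * σ` proportional to `log log n`
gives an error of smaller order than `log n` and a main term of order `t log n log log n`. The
constant `D` is taken so large that only half of the main term is claimed; the other half absorbs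
`log t`, `α` and all errors, so the `o(1)` term can be taken to be zero. -/

variable {b : ℕ}

/-! ### Trees, external nodes and branches -/

/-- A finite set of nodes that contains the parent of each of its nodes. -/
def IsTree (S : Tree b) : Prop := ∀ u i, u ++ [i] ∈ S → u ∈ S

lemma IsTree.nil_mem {S : Tree b} (hS : IsTree S) (hne : S.Nonempty) : [] ∈ S := by
  obtain ⟨u, hu⟩ := hne
  induction u using List.reverseRecOn with
  | nil => exact hu
  | append_singleton u i ih => exact ih (hS u i hu)

lemma isTree_empty : IsTree (∅ : Tree b) := by simp [IsTree]

lemma IsTree.mem_of_prefix {S : Tree b} (hS : IsTree S) {u v : Node b} (huv : u <+: v)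
    (hv : v ∈ S) : u ∈ S := by
  obtain ⟨w, rfl⟩ := huv
  induction w using List.reverseRecOn with
  | nil => simpa using hv
  | append_singleton w i ih => exact ih (hS (u ++ w) i (by simpa using hv))

lemma mem_external {S : Tree b} {v : Node b} :
    v ∈ external S ↔ (v = [] ∨ ∃ u ∈ S, ∃ i, v = u ++ [i]) ∧ v ∉ S := by
  simp only [external, Finset.mem_sdiff, Finset.mem_insert, Finset.mem_biUnion, Finset.mem_image,
    Finset.mem_univ, true_and]
  simp only [eq_comm]

lemma not_mem_of_mem_external {S : Tree b} {v : Node b} (h : v ∈ external S) : v ∉ S :=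
  (mem_external.1 h).2

lemma external_empty : external (∅ : Tree b) = {[]} := by
  ext v; simp [mem_external]

/-- The internal and external nodes together are the root and all children of internal nodes, each
exactly once. Counting nodes and depths and reindexing tolls are instances of this identity. -/
lemma sum_external_add_sum {S : Tree b} (hS : IsTree S) (f : Node b → ℝ) :
    ∑ v ∈ external S, f v + ∑ v ∈ S, f v = f [] + ∑ u ∈ S, ∑ i, f (u ++ [i]) := by
  have hsub : S ⊆ insert [] (S.biUnion fun u => Finset.univ.image fun i : Fin b => u ++ [i]) := by
    intro v hv
    rcases List.eq_nil_or_concat v with rfl | ⟨u, i, rfl⟩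
    · simp
    · have := hS u i (by simpa using hv)
      simp only [Finset.mem_insert, Finset.mem_biUnion, Finset.mem_image]
      exact Or.inr ⟨u, this, i, by simp, by simp⟩
  rw [external, Finset.sum_sdiff hsub, Finset.sum_insert, Finset.sum_biUnion]
  · congr 1
    refine Finset.sum_congr rfl fun u _ => ?_
    rw [Finset.sum_image]
    intro i _ j _ h
    simpa using h
  · intro u _ v _ huv
    simp only [Function.onFun, Finset.disjoint_left, Finset.mem_image, not_exists]
    rintro _ ⟨i, -, rfl⟩ j ⟨-, h⟩
    exact huv (List.append_inj' h rfl).1.symm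
  · simp

lemma card_external {S : Tree b} (hS : IsTree S) :
    ((external S).card : ℝ) = (b - 1) * S.card + 1 := by
  have h := sum_external_add_sum hS (fun _ => 1)
  simp only [Finset.sum_const, nsmul_eq_mul, mul_one, Finset.card_univ, Fintype.card_fin] at h
  linarith

lemma sum_length_external {S : Tree b} (hS : IsTree S) :
    ∑ v ∈ external S, (v.length : ℝ) = (b - 1) * ∑ v ∈ S, (v.length : ℝ) + b * S.card := by
  have h := sum_external_add_sum hS (fun v => (v.length : ℝ))
  simp only [Finset.sum_const, Finset.card_univ, Fintype.card_fin, List.length_append,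
    List.length_nil, List.length_cons, Nat.cast_add, Nat.cast_zero, zero_add, Nat.cast_one,
    nsmul_eq_mul, ← Finset.mul_sum, Finset.sum_add_distrib, mul_one] at h
  linarith

lemma card_external_pos (hb : 1 ≤ b) {S : Tree b} (hS : IsTree S) :
    (0 : ℝ) < (external S).card := by
  rw [card_external hS]
  have : (1 : ℝ) ≤ b := by exact_mod_cast hb
  nlinarith [mul_nonneg (sub_nonneg.2 this) (Nat.cast_nonneg (α := ℝ) S.card)]

lemma IsTree.insert {S : Tree b} (hS : IsTree S) {v : Node b} (hv : v ∈ external S) :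
    IsTree (insert v S) := by
  intro u i h
  rw [Finset.mem_insert] at h ⊢
  rcases h with h | h
  · rcases (mem_external.1 hv).1 with rfl | ⟨w, hw, j, rfl⟩
    · simp at h
    · rw [(List.append_inj' h rfl).1]
      exact Or.inr hw
  · exact Or.inr (hS u i h)

/-- The subtree of `S` rooted at the `i`-th child of the root. -/
noncomputable def branch (i : Fin b) (S : Tree b) : Tree b :=
  S.preimage (fun u => i :: u) (List.cons_injective.injOn)

@[simp] lemma mem_branch {i : Fin b} {S : Tree b} {u : Node b} : u ∈ branch i S ↔ i :: u ∈ S := by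
  simp [branch]

lemma IsTree.branch {S : Tree b} (hS : IsTree S) (i : Fin b) : IsTree (branch i S) := by
  intro u j h
  simp only [mem_branch] at h ⊢
  exact hS (i :: u) j (by simpa using h)

@[to_additive]
lemma prod_eq_prod_branch {M : Type*} [CommMonoid M] {S : Tree b} (hS : [] ∉ S) (f : Node b → M) :
    ∏ u ∈ S, f u = ∏ i, ∏ u ∈ branch i S, f (i :: u) := by
  rw [Finset.prod_sigma']
  symm
  refine Finset.prod_bij (fun x _ => x.1 :: x.2) ?_ ?_ ?_ ?_
  · rintro ⟨i, u⟩ h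
    simpa using h
  · rintro ⟨i, u⟩ _ ⟨j, v⟩ _ h
    simp only [List.cons.injEq] at h
    obtain ⟨rfl, rfl⟩ := h
    rfl
  · intro v hv
    cases v with
    | nil => exact absurd hv hS
    | cons i u => exact ⟨⟨i, u⟩, by simpa using hv, rfl⟩
  · rintro ⟨i, u⟩ _
    rfl

@[to_additive]
lemma prod_eq_mul_prod_branch {M : Type*} [CommMonoid M] {S : Tree b} (hS : [] ∈ S)
    (f : Node b → M) :
    ∏ u ∈ S, f u = f [] * ∏ i, ∏ u ∈ branch i S, f (i :: u) := by
  rw [← Finset.mul_prod_erase S f hS, prod_eq_prod_branch (by simp)]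
  congr 1
  refine Finset.prod_congr rfl fun i _ => ?_
  refine Finset.prod_congr ?_ fun _ _ => rfl
  ext u; simp

lemma branch_external {S : Tree b} (hS : [] ∈ S) (i : Fin b) :
    branch i (external S) = external (branch i S) := by
  ext w
  simp only [mem_branch, mem_external, reduceCtorEq, false_or]
  refine and_congr_left fun _ => ⟨?_, ?_⟩
  · rintro ⟨u, hu, j, h⟩
    cases u with
    | nil => left; simpa using congrArg List.tail h
    | cons k u =>
      simp only [List.cons_append, List.cons.injEq] at h
      obtain ⟨rfl, rfl⟩ := h
      exact Or.inr ⟨u, hu, j, rfl⟩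
  · rintro (rfl | ⟨u, hu, j, rfl⟩)
    · exact ⟨[], hS, i, rfl⟩
    · exact ⟨i :: u, hu, j, rfl⟩

lemma branch_insert (i j : Fin b) (v : Node b) (S : Tree b) :
    branch j (insert (i :: v) S) = if j = i then insert v (branch j S) else branch j S := by
  ext u
  split_ifs with h <;> simp [h]

lemma card_eq_sum_branch {S : Tree b} (hS : [] ∈ S) :
    S.card = 1 + ∑ i, (branch i S).card := by
  have h := sum_eq_add_sum_branch hS (fun _ => 1)
  simpa using h

/-! ### Subtree sizes, and the two functionals as toll sums -/

/-- Number of nodes of `S` that descend from `v`, including `v` itself. -/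
def size (S : Tree b) (v : Node b) : ℕ := (S.filter fun w => v <+: w).card

lemma size_cons (S : Tree b) (i : Fin b) (u : Node b) : size S (i :: u) = size (branch i S) u := by
  unfold size
  symm
  refine Finset.card_bij (fun w _ => i :: w) ?_ ?_ ?_
  · intro w hw
    simpa using hw
  · intro w _ w' _ h
    simpa using h
  · intro w hw
    simp only [Finset.mem_filter] at hw
    cases w with
    | nil => simp at hw
    | cons j w =>
      have := hw.2
      rw [List.cons_prefix_cons] at this
      obtain ⟨rfl, h⟩ := this
      exact ⟨w, by simpa [h] using hw.1, rfl⟩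

lemma size_nil (S : Tree b) : size S [] = S.card := by simp [size]

lemma size_eq_zero {S : Tree b} (hS : IsTree S) {v : Node b} (hv : v ∉ S) : size S v = 0 := by
  simp only [size, Finset.card_eq_zero, Finset.filter_eq_empty_iff]
  exact fun w hw h => hv (hS.mem_of_prefix h hw)

/-- Sum over the edges of `S` of a function `c` of the number of nodes below the edge. -/
noncomputable def toll (c : ℕ → ℝ) (S : Tree b) : ℝ := ∑ u ∈ S, ∑ i, c (size S (u ++ [i]))

lemma toll_eq {S : Tree b} (hS : [] ∈ S) (c : ℕ → ℝ) :
    toll c S = ∑ i, (c (branch i S).card + toll c (branch i S)) := by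
  rw [toll, sum_eq_add_sum_branch hS, Finset.sum_add_distrib]
  simp [size_cons, size_nil, toll]

/-- The children lying outside `S` have no descendants in `S`, so they contribute `c 0 = 0`, and
edges may be indexed by their lower end point. -/
lemma toll_eq_sum {S : Tree b} (hS : IsTree S) {c : ℕ → ℝ} (hc : c 0 = 0) :
    toll c S = ∑ v ∈ S, (if v = [] then 0 else c (size S v)) := by
  have h := sum_external_add_sum hS (fun v => if v = [] then 0 else c (size S v))
  rw [Finset.sum_eq_zero] at h
  · simpa [toll] using h.symm
  · intro v hv
    rw [size_eq_zero hS (not_mem_of_mem_external hv), hc, ite_self]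

lemma card_rootPath (u : Node b) : (rootPath u).card = u.length := by
  have hn : u.inits.Nodup := by
    rw [List.nodup_iff_injective_get]
    intro i j h
    simp only [List.get_eq_getElem, List.getElem_inits] at h
    have := congrArg List.length h
    have hi := i.2
    have hj := j.2
    simp only [List.length_inits] at hi hj
    simp only [List.length_take] at this
    ext; omega
  rw [rootPath, Finset.card_erase_of_mem (by simp), List.toFinset_card_of_nodup hn]
  simp

lemma mem_rootPath {u w : Node b} : w ∈ rootPath u ↔ w ≠ [] ∧ w <+: u := by
  simp [rootPath]

lemma IsTree.rootPath_subset {S : Tree b} (hS : IsTree S) {u : Node b} (hu : u ∈ S) :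
    rootPath u ⊆ S := fun _ hw => hS.mem_of_prefix (mem_rootPath.1 hw).2 hu

lemma toll_id {S : Tree b} (hS : IsTree S) :
    toll (fun k => (k : ℝ)) S = ∑ u ∈ S, (u.length : ℝ) := by
  rw [toll_eq_sum hS (by simp)]
  have : ∀ u ∈ S, (u.length : ℝ) = ∑ v ∈ S, if v ∈ rootPath u then 1 else 0 := by
    intro u hu
    rw [← card_rootPath, Finset.sum_ite_mem, Finset.inter_eq_right.2 (hS.rootPath_subset hu)]
    simp
  rw [Finset.sum_congr rfl this, Finset.sum_comm]
  refine Finset.sum_congr rfl fun v _ => ?_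
  simp only [mem_rootPath, size]
  split_ifs with h <;> simp [h]

/-- Sum over the edges of `S` of the edge weight times a function `c` of the number of nodes below
the edge. -/
noncomputable def wtoll (c : ℕ → ℝ) (x : Tree b × Weights b) : ℝ :=
  ∑ u ∈ x.1, ∑ i, x.2 u i * c (size x.1 (u ++ [i]))

lemma edgeWeight_append (z : Weights b) (u : Node b) (i : Fin b) :
    edgeWeight z (u ++ [i]) = z u i := by
  simp [edgeWeight]

lemma edgeWeight_nil (z : Weights b) : edgeWeight z [] = 0 := by
  simp [edgeWeight]

lemma wtoll_eq_sum {S : Tree b} (hS : IsTree S) {c : ℕ → ℝ} (hc : c 0 = 0) (z : Weights b) :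
    wtoll c (S, z) = ∑ v ∈ S, edgeWeight z v * c (size S v) := by
  have h := sum_external_add_sum hS (fun v => edgeWeight z v * c (size S v))
  rw [Finset.sum_eq_zero] at h
  · simpa [wtoll, edgeWeight_append, edgeWeight_nil] using h.symm
  · intro v hv
    rw [size_eq_zero hS (not_mem_of_mem_external hv), hc, mul_zero]

lemma pathLength_eq_wtoll {S : Tree b} (hS : IsTree S) (z : Weights b) :
    pathLength (S, z) = wtoll (fun k => (k : ℝ)) (S, z) := by
  rw [wtoll_eq_sum hS (by simp)]
  have h : ∀ u ∈ S, wdist z [] u = ∑ v ∈ S, if v ∈ rootPath u then edgeWeight z v else 0 := by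
    intro u hu
    have h0 : symmDiff (rootPath ([] : Node b)) (rootPath u) = rootPath u := by
      ext w; simp [Finset.mem_symmDiff, mem_rootPath]
    rw [wdist, h0, Finset.sum_ite_mem, Finset.inter_eq_right.2 (hS.rootPath_subset hu)]
  rw [pathLength, Finset.sum_congr rfl h, Finset.sum_comm]
  refine Finset.sum_congr rfl fun v _ => ?_
  by_cases hv : v = []
  · simp [hv, edgeWeight_nil]
  · simp [mem_rootPath, hv, size, ← Finset.sum_filter, mul_comm]

/-- An edge lies on the path between two nodes exactly when one of them is below it and the other is
not, which happens for `k * (S.card - k)` unordered pairs if `k` nodes are below. -/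
lemma wienerIndex_eq_wtoll {S : Tree b} (hS : IsTree S) (z : Weights b) :
    wienerIndex (S, z) = wtoll (fun k => (S.card : ℝ) * k - (k : ℝ) ^ 2) (S, z) := by
  rw [wtoll_eq_sum hS (by simp)]
  have h : ∀ u ∈ S, ∀ v ∈ S, wdist z u v = ∑ w ∈ S, edgeWeight z w *
      (((if w <+: u then 1 else 0) * (1 - if w <+: v then 1 else 0)) +
       ((if w <+: v then 1 else 0) * (1 - if w <+: u then 1 else 0))) := by
    intro u hu v hv
    have hsub : symmDiff (rootPath u) (rootPath v) ⊆ S := by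
      intro w hw
      rcases Finset.mem_symmDiff.1 hw with h | h
      exacts [hS.rootPath_subset hu h.1, hS.rootPath_subset hv h.1]
    rw [wdist, ← Finset.inter_eq_right.2 hsub, ← Finset.sum_ite_mem]
    refine Finset.sum_congr rfl fun w _ => ?_
    by_cases hw : w = []
    · simp [hw, edgeWeight_nil]
    · simp only [Finset.mem_symmDiff, mem_rootPath, ne_eq, hw, not_false_eq_true, true_and]
      by_cases h1 : w <+: u <;> by_cases h2 : w <+: v <;> simp [h1, h2]
  rw [wienerIndex]
  simp only
  rw [Finset.sum_congr rfl fun u hu => Finset.sum_congr rfl fun v hv => h u hu v hv,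
    Finset.sum_congr rfl fun u _ => Finset.sum_comm, Finset.sum_comm, Finset.sum_div]
  refine Finset.sum_congr rfl fun w _ => ?_
  have hs : ∑ u ∈ S, (if w <+: u then (1 : ℝ) else 0) = size S w := by
    simp [size]
  simp only [← Finset.mul_sum, Finset.sum_add_distrib, Finset.sum_sub_distrib, mul_sub,
    ← Finset.sum_mul, hs, Finset.sum_const, nsmul_eq_mul, mul_one]
  ring

/-! ### Averages over tree growth as positive linear functionals -/

/-- Average over one growth step. -/
noncomputable def growAvg (b : ℕ) : (Tree b → ℝ) →ₗ[ℝ] (Tree b → ℝ) where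
  toFun f S := (∑ v ∈ external S, f (insert v S)) / (external S).card
  map_add' f g := by ext S; simp [Finset.sum_add_distrib, add_div]
  map_smul' r f := by ext S; simp [← Finset.mul_sum, mul_div_assoc]

/-- Average over the random tree of size `n`. -/
noncomputable def treeAvg (b : ℕ) : ℕ → (Tree b → ℝ) →ₗ[ℝ] ℝ
  | 0 => LinearMap.proj ∅
  | n + 1 => treeAvg b n ∘ₗ growAvg b

lemma growAvg_apply (f : Tree b → ℝ) (S : Tree b) :
    growAvg b f S = (∑ v ∈ external S, f (insert v S)) / (external S).card := rfl

lemma treeAvg_zero (f : Tree b → ℝ) : treeAvg b 0 f = f ∅ := rfl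

lemma treeAvg_succ (n : ℕ) (f : Tree b → ℝ) : treeAvg b (n + 1) f = treeAvg b n (growAvg b f) := rfl

lemma treeAvg_mono (n : ℕ) {f g : Tree b → ℝ}
    (h : ∀ S, IsTree S → S.card = n → f S ≤ g S) : treeAvg b n f ≤ treeAvg b n g := by
  induction n generalizing f g with
  | zero => exact h ∅ isTree_empty rfl
  | succ n ih =>
    refine ih fun S hS hc => ?_
    simp only [growAvg_apply]
    gcongr with v hv
    refine h _ (hS.insert hv) ?_
    rw [Finset.card_insert_of_notMem (not_mem_of_mem_external hv), hc]

lemma treeAvg_congr (n : ℕ) {f g : Tree b → ℝ}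
    (h : ∀ S, IsTree S → S.card = n → f S = g S) : treeAvg b n f = treeAvg b n g :=
  le_antisymm (treeAvg_mono n fun S hS hc => (h S hS hc).le)
    (treeAvg_mono n fun S hS hc => (h S hS hc).ge)

lemma growAvg_const (hb : 1 ≤ b) {S : Tree b} (hS : IsTree S) (r : ℝ) :
    growAvg b (fun _ => r) S = r := by
  have := card_external_pos hb hS
  rw [growAvg_apply, Finset.sum_const, nsmul_eq_mul]
  field_simp

lemma treeAvg_const (hb : 1 ≤ b) (n : ℕ) (r : ℝ) : treeAvg b n (fun _ => r) = r := by
  induction n with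
  | zero => rfl
  | succ n ih =>
    rw [treeAvg_succ]
    conv_rhs => rw [← ih]
    exact treeAvg_congr n fun S hS _ => growAvg_const hb hS r

/-! ### The urn of branch sizes and the splitting at the root -/

/-- Average over one step of the urn that describes the sizes of the branches of the tree. -/
noncomputable def urnStep (b : ℕ) : ((Fin b → ℕ) → ℝ) →ₗ[ℝ] ((Fin b → ℕ) → ℝ) where
  toFun f k := ∑ i, (((b : ℝ) - 1) * k i + 1) / (((b : ℝ) - 1) * (∑ j, k j : ℕ) + b) *
    f (Function.update k i (k i + 1))
  map_add' f g := by ext k; simp [Finset.sum_add_distrib, mul_add]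
  map_smul' r f := by ext k; simp [Finset.mul_sum, mul_left_comm]

/-- Average over the urn after `n` steps. -/
noncomputable def urnAvg (b : ℕ) : ℕ → ((Fin b → ℕ) → ℝ) →ₗ[ℝ] ℝ
  | 0 => LinearMap.proj 0
  | n + 1 => urnAvg b n ∘ₗ urnStep b

lemma urnStep_apply (f : (Fin b → ℕ) → ℝ) (k : Fin b → ℕ) :
    urnStep b f k = ∑ i, (((b : ℝ) - 1) * k i + 1) / (((b : ℝ) - 1) * (∑ j, k j : ℕ) + b) *
      f (Function.update k i (k i + 1)) := rfl

lemma urnAvg_zero (f : (Fin b → ℕ) → ℝ) : urnAvg b 0 f = f 0 := rfl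

lemma urnAvg_succ (n : ℕ) (f : (Fin b → ℕ) → ℝ) :
    urnAvg b (n + 1) f = urnAvg b n (urnStep b f) := rfl

lemma sum_update_add_one (k : Fin b → ℕ) (i : Fin b) :
    ∑ j, Function.update k i (k i + 1) j = ∑ j, k j + 1 := by
  rw [Finset.sum_update_of_mem (Finset.mem_univ i), ← Finset.add_sum_erase _ k (Finset.mem_univ i),
    Finset.sdiff_singleton_eq_erase]
  ring

lemma urnAvg_mono (hb : 1 ≤ b) (n : ℕ) {f g : (Fin b → ℕ) → ℝ}
    (h : ∀ k, ∑ i, k i = n → f k ≤ g k) : urnAvg b n f ≤ urnAvg b n g := by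
  have hb' : (0 : ℝ) ≤ b - 1 := by
    have : (1 : ℝ) ≤ b := by exact_mod_cast hb
    linarith
  induction n generalizing f g with
  | zero => exact h 0 (by simp)
  | succ n ih =>
    refine ih fun k hk => ?_
    simp only [urnStep_apply]
    gcongr with i
    exact h _ (by rw [sum_update_add_one, hk])

lemma urnAvg_congr (hb : 1 ≤ b) (n : ℕ) {f g : (Fin b → ℕ) → ℝ}
    (h : ∀ k, ∑ i, k i = n → f k = g k) : urnAvg b n f = urnAvg b n g :=
  le_antisymm (urnAvg_mono hb n fun k hk => (h k hk).le)
    (urnAvg_mono hb n fun k hk => (h k hk).ge)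

lemma urnStep_weights (hb : 1 ≤ b) (k : Fin b → ℕ) :
    ∑ i, (((b : ℝ) - 1) * k i + 1) / (((b : ℝ) - 1) * (∑ j, k j : ℕ) + b) = 1 := by
  have hb' : (1 : ℝ) ≤ b := by exact_mod_cast hb
  rw [← Finset.sum_div, Finset.sum_add_distrib, ← Finset.mul_sum]
  simp only [Finset.sum_const, Finset.card_univ, Fintype.card_fin, nsmul_eq_mul, mul_one]
  rw [Nat.cast_sum]
  apply div_self
  have := mul_nonneg (sub_nonneg.2 hb') (Finset.sum_nonneg (s := Finset.univ) fun i _ =>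
    Nat.cast_nonneg (α := ℝ) (k i))
  linarith

lemma urnAvg_const (hb : 1 ≤ b) (n : ℕ) (r : ℝ) : urnAvg b n (fun _ => r) = r := by
  induction n with
  | zero => rfl
  | succ n ih =>
    rw [urnAvg_succ]
    conv_rhs => rw [← ih]
    congr 1
    ext k
    rw [urnStep_apply, ← Finset.sum_mul, urnStep_weights hb, one_mul]

/-- The new node falls into branch `i` with probability proportional to the number of its external
nodes and is then uniform there. Hence a growth step keeps the product form, changing only the
`i`-th factor; this is why the functions `f i` must be allowed to differ. -/
lemma growAvg_branches (hb : 1 ≤ b) (Ψ : (Fin b → ℕ) → ℝ) (f : Fin b → Tree b → ℝ) {S : Tree b}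
    (hS : IsTree S) (hnil : [] ∈ S) :
    growAvg b (fun S => Ψ (fun i => (branch i S).card) * ∏ i, f i (branch i S)) S =
      ∑ i, ((((b : ℝ) - 1) * (branch i S).card + 1) /
          (((b : ℝ) - 1) * (∑ j, (branch j S).card : ℕ) + b) *
          Ψ (Function.update (fun j => (branch j S).card) i ((branch i S).card + 1))) *
        ∏ j, Function.update f i (growAvg b (f i)) j (branch j S) := by
  rw [growAvg_apply, sum_eq_sum_branch (fun h => not_mem_of_mem_external h hnil), Finset.sum_div]
  refine Finset.sum_congr rfl fun i _ => ?_
  rw [branch_external hnil, card_external hS, card_eq_sum_branch hnil]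
  have hpos := card_external_pos hb (hS.branch i)
  have hcard := card_external (hS.branch i)
  have h1 : ∀ v ∈ external (branch i S),
      Ψ (fun j => (branch j (insert (i :: v) S)).card) * ∏ j, f j (branch j (insert (i :: v) S)) =
      Ψ (Function.update (fun j => (branch j S).card) i ((branch i S).card + 1)) *
        (∏ j ∈ Finset.univ.erase i, f j (branch j S)) * f i (insert v (branch i S)) := by
    intro v hv
    rw [← Finset.mul_prod_erase _ _ (Finset.mem_univ i), mul_assoc]
    congr 1
    · congr 1
      ext j
      rw [branch_insert]
      by_cases hj : j = i
      · subst hj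
        simp [Finset.card_insert_of_notMem (not_mem_of_mem_external hv)]
      · simp [hj]
    · rw [mul_comm, branch_insert, if_pos rfl]
      congr 1
      refine Finset.prod_congr rfl fun j hj => ?_
      rw [branch_insert, if_neg (Finset.ne_of_mem_erase hj)]
  rw [Finset.sum_congr rfl h1, ← Finset.mul_sum, ← Finset.mul_prod_erase _ _ (Finset.mem_univ i)]
  have h2 : ∏ j ∈ Finset.univ.erase i, Function.update f i (growAvg b (f i)) j (branch j S) =
      ∏ j ∈ Finset.univ.erase i, f j (branch j S) := by
    refine Finset.prod_congr rfl fun j hj => ?_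
    rw [Function.update_of_ne (Finset.ne_of_mem_erase hj)]
  rw [h2, Function.update_self, growAvg_apply, ← hcard]
  have h3 : ((b : ℝ) - 1) * ((1 + ∑ j, (branch j S).card : ℕ) : ℝ) + 1 =
      ((b : ℝ) - 1) * ((∑ j, (branch j S).card : ℕ) : ℝ) + b := by push_cast; ring
  rw [h3]
  field_simp

/-- The branches of the random tree are independent given their sizes, which follow the urn. -/
theorem treeAvg_branches (hb : 1 ≤ b) (n : ℕ) (Ψ : (Fin b → ℕ) → ℝ) (f : Fin b → Tree b → ℝ) :
    treeAvg b (n + 1) (fun S => Ψ (fun i => (branch i S).card) * ∏ i, f i (branch i S)) =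
      urnAvg b n (fun k => Ψ k * ∏ i, treeAvg b (k i) (f i)) := by
  induction n generalizing Ψ f with
  | zero =>
    have h : ∀ i : Fin b, branch i {[]} = ∅ := fun i => by ext; simp
    rw [treeAvg_succ, treeAvg_zero, growAvg_apply, external_empty]
    simp [h, urnAvg_zero, treeAvg_zero]
    exact Or.inl rfl
  | succ n ih =>
    have h1 := treeAvg_congr (b := b) (n + 1)
      (f := growAvg b (fun S => Ψ (fun i => (branch i S).card) * ∏ i, f i (branch i S)))
      (g := ∑ i, fun S : Tree b => ((((b : ℝ) - 1) * (branch i S).card + 1) /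
          (((b : ℝ) - 1) * (∑ j, (branch j S).card : ℕ) + b) *
          Ψ (Function.update (fun j => (branch j S).card) i ((branch i S).card + 1))) *
        ∏ j, Function.update f i (growAvg b (f i)) j (branch j S)) (by
        intro S hS hc
        rw [growAvg_branches hb Ψ f hS (hS.nil_mem (Finset.card_pos.1 (by omega)))]
        simp)
    rw [treeAvg_succ, h1, map_sum, urnAvg_succ]
    have h2 : urnStep b (fun k => Ψ k * ∏ i, treeAvg b (k i) (f i)) =
        ∑ i, fun k : Fin b → ℕ => ((((b : ℝ) - 1) * k i + 1) /
          (((b : ℝ) - 1) * (∑ j, k j : ℕ) + b) * Ψ (Function.update k i (k i + 1))) *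
          ∏ j, treeAvg b (k j) (Function.update f i (growAvg b (f i)) j) := by
      ext k
      rw [urnStep_apply, Finset.sum_apply]
      refine Finset.sum_congr rfl fun i _ => ?_
      rw [mul_assoc]
      congr 2
      refine Finset.prod_congr rfl fun j _ => ?_
      by_cases hj : j = i
      · subst hj
        simp [treeAvg_succ]
      · simp [hj]
    rw [h2, map_sum]
    exact Finset.sum_congr rfl fun i _ => ih (fun k => (((b : ℝ) - 1) * k i + 1) /
          (((b : ℝ) - 1) * (∑ j, k j : ℕ) + b) * Ψ (Function.update k i (k i + 1)))
          (Function.update f i (growAvg b (f i)))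

/-! ### The recursion for mean tolls -/

/-- Mean of `toll` over the random tree of size `n`. -/
noncomputable def meanToll (b : ℕ) (c : ℕ → ℝ) (n : ℕ) : ℝ := treeAvg b n (toll c)

lemma treeAvg_branch (hb : 1 ≤ b) (n : ℕ) (i : Fin b) (f : Tree b → ℝ) :
    treeAvg b (n + 1) (fun S => f (branch i S)) = urnAvg b n (fun k => treeAvg b (k i) f) := by
  have h := treeAvg_branches hb n (fun _ => 1) (Function.update (fun _ _ => 1) i f)
  have hp : ∀ (F : Fin b → (Tree b → ℝ) → ℝ), (∀ j, F j (fun _ => 1) = 1) →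
      ∏ j, F j (Function.update (fun _ _ => 1) i f j) = F i f := by
    intro F hF
    rw [Finset.prod_eq_single i]
    · simp
    · intro j _ hj
      rw [Function.update_of_ne hj]
      exact hF j
    · simp
  have h1 := fun S : Tree b => hp (fun j g => g (branch j S)) (fun _ => rfl)
  have h2 := fun k : Fin b → ℕ => hp (fun j g => treeAvg b (k j) g)
    (fun j => treeAvg_const hb (k j) 1)
  simp only [one_mul, h1, h2] at h
  exact h

lemma meanToll_zero (c : ℕ → ℝ) : meanToll b c 0 = 0 := by
  simp [meanToll, treeAvg_zero, toll]

lemma meanToll_succ (hb : 1 ≤ b) (c : ℕ → ℝ) (n : ℕ) :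
    meanToll b c (n + 1) = urnAvg b n (fun k => ∑ i, (c (k i) + meanToll b c (k i))) := by
  rw [meanToll, treeAvg_congr (n + 1) (g := ∑ i, fun S : Tree b =>
    (fun T : Tree b => c T.card + toll c T) (branch i S)), map_sum]
  · simp only [treeAvg_branch hb n _ (fun T : Tree b => c T.card + toll c T)]
    rw [← map_sum]
    congr 1
    ext k
    rw [Finset.sum_apply]
    refine Finset.sum_congr rfl fun i _ => ?_
    rw [meanToll, ← treeAvg_const hb (k i) (c (k i)), ← map_add]
    refine treeAvg_congr _ fun S _ hc => ?_
    rw [Pi.add_apply, hc]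
  · intro S hS hc
    rw [toll_eq (hS.nil_mem (Finset.card_pos.1 (by omega))), Finset.sum_apply]

/-! ### The spread of the branch sizes -/

/-- The part of the tree outside the `i`-th branch is rarely small. -/
lemma urnAvg_card_compl_le (hb : 2 ≤ b) (n : ℕ) (i : Fin b) (x : ℕ) :
    urnAvg b n (fun k => if 1 + ∑ j, k j ≤ k i + x then 1 else 0) ≤ (x : ℝ) / (n + 1) := by
  have hb' : (2 : ℝ) ≤ b := by exact_mod_cast hb
  have hle : ∀ k : Fin b → ℕ, k i ≤ ∑ j, k j := fun k =>
    Finset.single_le_sum (fun _ _ => Nat.zero_le _) (Finset.mem_univ i)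
  have hx0 : ∀ n, urnAvg b n (fun k => if 1 + ∑ j, k j ≤ k i + 0 then (1 : ℝ) else 0) = 0 := by
    intro n
    rw [urnAvg_congr (by omega) n (g := fun _ => 0), urnAvg_const (by omega)]
    intro k _
    have := hle k
    rw [if_neg (by omega)]
  induction n generalizing x with
  | zero =>
    rw [urnAvg_zero]
    rcases Nat.eq_zero_or_pos x with rfl | hx
    · simp
    · have : (1 : ℝ) ≤ x := by exact_mod_cast hx
      simp only [Nat.cast_zero, zero_add, div_one]
      split_ifs <;> linarith
  | succ n ih =>
    rcases Nat.eq_zero_or_pos x with rfl | hx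
    · rw [hx0]; positivity
    by_cases hxn : n + 2 ≤ x
    · calc _ ≤ urnAvg b (n + 1) (fun _ => 1) := by
            refine urnAvg_mono (by omega) _ fun k _ => ?_
            split_ifs <;> norm_num
        _ = 1 := urnAvg_const (by omega) _ _
        _ ≤ _ := by
            rw [le_div_iff₀ (by positivity)]
            have : ((n + 2 : ℕ) : ℝ) ≤ x := by exact_mod_cast hxn
            push_cast at this ⊢
            linarith
    · obtain ⟨y, rfl⟩ : ∃ y, x = y + 1 := ⟨x - 1, by omega⟩
      set a : ℝ := ((b : ℝ) - 1) * n + b with ha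
      have hapos : 0 < a := by
        have : (0 : ℝ) ≤ n := n.cast_nonneg
        nlinarith
      set r : ℝ := ((b : ℝ) - 1) * (y + 1) / a with hr
      -- A step into branch `i` keeps the threshold `y + 1`, any other step lowers it to `y`. The
      -- two indicators differ only when `k i = n - y`, and there `r` is the probability of missing
      -- branch `i`.
      have hstep : ∀ k : Fin b → ℕ, ∑ j, k j = n →
          urnStep b (fun k => if 1 + ∑ j, k j ≤ k i + (y + 1) then (1 : ℝ) else 0) k =
          (1 - r) * (if 1 + ∑ j, k j ≤ k i + (y + 1) then (1 : ℝ) else 0) +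
          r * (if 1 + ∑ j, k j ≤ k i + y then (1 : ℝ) else 0) := by
        intro k hk
        have hw := urnStep_weights (b := b) (by omega) k
        rw [urnStep_apply, ← Finset.add_sum_erase _ _ (Finset.mem_univ i)]
        rw [← Finset.add_sum_erase _ _ (Finset.mem_univ i)] at hw
        have h2 : ∀ j ∈ Finset.univ.erase i,
            (((b : ℝ) - 1) * k j + 1) / (((b : ℝ) - 1) * (∑ j, k j : ℕ) + b) *
            (if 1 + ∑ l, Function.update k j (k j + 1) l ≤
              Function.update k j (k j + 1) i + (y + 1) then (1 : ℝ) else 0) =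
            (((b : ℝ) - 1) * k j + 1) / (((b : ℝ) - 1) * (∑ j, k j : ℕ) + b) *
            (if 1 + ∑ l, k l ≤ k i + y then (1 : ℝ) else 0) := by
          intro j hj
          rw [sum_update_add_one, Function.update_of_ne (Finset.ne_of_mem_erase hj).symm]
          congr 2
          exact propext ⟨fun h => by omega, fun h => by omega⟩
        rw [Finset.sum_congr rfl h2, ← Finset.sum_mul, eq_sub_of_add_eq' hw, sum_update_add_one,
          Function.update_self, hk]
        have h3 : (1 + (n + 1) ≤ k i + 1 + (y + 1)) = (1 + n ≤ k i + (y + 1)) :=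
          propext ⟨fun h => by omega, fun h => by omega⟩
        simp only [h3]
        rw [← ha]
        by_cases h4 : 1 + n ≤ k i + y
        · rw [if_pos h4, if_pos (by omega)]; ring
        by_cases h5 : 1 + n ≤ k i + (y + 1)
        · rw [if_pos h5, if_neg h4]
          have h6 : (k i : ℝ) = n - y := by
            have : k i + y = n := by omega
            rw [← this]; push_cast; ring
          rw [hr, h6]
          field_simp
          rw [ha]; ring
        · rw [if_neg h5, if_neg h4]; ring
      rw [urnAvg_succ, urnAvg_congr (by omega) n hstep]
      have hsplit : (fun k : Fin b → ℕ =>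
          (1 - r) * (if 1 + ∑ j, k j ≤ k i + (y + 1) then (1 : ℝ) else 0) +
          r * (if 1 + ∑ j, k j ≤ k i + y then (1 : ℝ) else 0)) =
          (1 - r) • (fun k : Fin b → ℕ => if 1 + ∑ j, k j ≤ k i + (y + 1) then (1 : ℝ) else 0) +
          r • (fun k : Fin b → ℕ => if 1 + ∑ j, k j ≤ k i + y then (1 : ℝ) else 0) := by
        ext k; simp
      rw [hsplit, map_add, map_smul, map_smul, smul_eq_mul, smul_eq_mul]
      have hyn : ((y : ℝ) + 1) ≤ n + 1 := by
        have : y + 1 ≤ n + 1 := by omega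
        exact_mod_cast this
      have hr0 : 0 ≤ r := by
        have : (0 : ℝ) ≤ y := y.cast_nonneg
        apply div_nonneg _ hapos.le
        nlinarith
      have hr1 : r ≤ 1 := by
        rw [hr, div_le_one hapos]
        nlinarith
      have e1 := mul_le_mul_of_nonneg_left (ih (y + 1)) (sub_nonneg.2 hr1)
      have e2 := mul_le_mul_of_nonneg_left (ih y) hr0
      refine (add_le_add e1 e2).trans ?_
      have hn0 : (0 : ℝ) ≤ n := n.cast_nonneg
      have hy0 : (0 : ℝ) ≤ y := y.cast_nonneg
      have e3 : (1 - r) * (((y + 1 : ℕ) : ℝ) / (n + 1)) + r * ((y : ℝ) / (n + 1)) =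
          (y + 1) * (1 - (b - 1) / a) / (n + 1) := by
        rw [hr]; push_cast; field_simp; ring
      rw [e3, div_le_div_iff₀ (by positivity) (by positivity)]
      push_cast
      -- After clearing `a` this amounts to `2 ≤ b`, with equality for `b = 2`, where the branch
      -- sizes are uniform.
      have e4 : (1 - ((b : ℝ) - 1) / a) * (n + 2) ≤ n + 1 := by
        rw [one_sub_div hapos.ne', div_mul_eq_mul_div, div_le_iff₀ hapos, ha]
        nlinarith
      nlinarith

/-- One minus the sum of the squares of the relative sizes of the branches. -/
noncomputable def spread (n : ℕ) (k : Fin b → ℕ) : ℝ := 1 - ∑ i, ((k i : ℝ) / (n + 1)) ^ 2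

lemma spread_le_one (n : ℕ) (k : Fin b → ℕ) : spread n k ≤ 1 := by
  rw [spread, sub_le_self_iff]
  positivity

lemma sum_div_le_one {n : ℕ} {k : Fin b → ℕ} (hk : ∑ i, k i = n) :
    ∑ i, (k i : ℝ) / (n + 1) ≤ 1 := by
  rw [← Finset.sum_div, ← Nat.cast_sum, hk, div_le_one (by positivity)]
  linarith

lemma div_le_one_of_sum_eq {n : ℕ} {k : Fin b → ℕ} (hk : ∑ i, k i = n) (i : Fin b) :
    (k i : ℝ) / (n + 1) ≤ 1 :=
  (Finset.single_le_sum (f := fun i => (k i : ℝ) / (n + 1)) (fun _ _ => by positivity)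
    (Finset.mem_univ i)).trans (sum_div_le_one hk)

lemma spread_nonneg {n : ℕ} {k : Fin b → ℕ} (hk : ∑ i, k i = n) : 0 ≤ spread n k := by
  rw [spread, sub_nonneg]
  refine le_trans (Finset.sum_le_sum fun i _ => ?_) (sum_div_le_one hk)
  rw [sq]
  exact mul_le_of_le_one_left (by positivity) (div_le_one_of_sum_eq hk i)

/-- Take the largest branch: a sum of squares is at most the largest term times the sum, and the
relative sizes sum to at most one. -/
lemma exists_le_spread (hb : 1 ≤ b) {n : ℕ} {k : Fin b → ℕ} (hk : ∑ i, k i = n) :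
    ∃ i, 1 - (k i : ℝ) / (n + 1) ≤ spread n k := by
  have : Nonempty (Fin b) := ⟨⟨0, hb⟩⟩
  obtain ⟨i, hi⟩ := Finite.exists_max k
  refine ⟨i, ?_⟩
  rw [spread, sub_le_sub_iff_left]
  calc ∑ j, ((k j : ℝ) / (n + 1)) ^ 2 ≤ ∑ j, (k i : ℝ) / (n + 1) * ((k j : ℝ) / (n + 1)) := by
        refine Finset.sum_le_sum fun j _ => ?_
        rw [sq]
        gcongr
        exact hi j
    _ = (k i : ℝ) / (n + 1) * ∑ j, (k j : ℝ) / (n + 1) := by rw [Finset.mul_sum]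
    _ ≤ _ := mul_le_of_le_one_right (by positivity) (sum_div_le_one hk)

-- A small spread forces some branch to contain almost all nodes, and a union bound over the
-- branches applies.
open Classical in
lemma urnAvg_spread_le (hb : 2 ≤ b) (n : ℕ) {δ : ℝ} (hδ : 0 ≤ δ) :
    urnAvg b n (fun k => if spread n k ≤ δ then 1 else 0) ≤ b * δ := by
  calc urnAvg b n (fun k => if spread n k ≤ δ then 1 else 0)
      ≤ urnAvg b n (∑ i, fun k : Fin b → ℕ =>
        if 1 + ∑ j, k j ≤ k i + ⌊δ * (n + 1)⌋₊ then (1 : ℝ) else 0) := by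
        refine urnAvg_mono (by omega) n fun k hk => ?_
        rw [Finset.sum_apply]
        split_ifs with h
        · obtain ⟨i, hi⟩ := exists_le_spread (by omega) hk
          have h1 : ((n + 1 - k i : ℕ) : ℝ) ≤ δ * (n + 1) := by
            have hki : k i ≤ n := hk ▸ Finset.single_le_sum (fun _ _ => Nat.zero_le _)
              (Finset.mem_univ i)
            rw [Nat.cast_sub (by omega)]
            have := hi.trans h
            rw [one_sub_div (by positivity), div_le_iff₀ (by positivity)] at this
            push_cast
            exact this
          have h2 := Nat.le_floor h1
          refine le_trans ?_ (Finset.single_le_sum (fun i _ => ?_) (Finset.mem_univ i))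
          · rw [if_pos (by omega)]
          · split_ifs <;> norm_num
        · refine Finset.sum_nonneg fun i _ => ?_
          split_ifs <;> norm_num
    _ = ∑ i, urnAvg b n (fun k : Fin b → ℕ =>
        if 1 + ∑ j, k j ≤ k i + ⌊δ * (n + 1)⌋₊ then (1 : ℝ) else 0) := map_sum _ _ _
    _ ≤ ∑ i : Fin b, δ := by
        refine Finset.sum_le_sum fun i _ => (urnAvg_card_compl_le hb n i _).trans ?_
        rw [div_le_iff₀ (by positivity)]
        exact Nat.floor_le (by positivity)
    _ = b * δ := by simp

/-- The spread exceeds `1 / (2 * b)` with probability at least one half. -/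
lemma le_urnAvg_spread (hb : 2 ≤ b) (n : ℕ) : 1 / (4 * b : ℝ) ≤ urnAvg b n (spread n) := by
  classical
  have hb' : (2 : ℝ) ≤ b := by exact_mod_cast hb
  have h := urnAvg_spread_le hb n (δ := 1 / (2 * b)) (by positivity)
  have h2 : urnAvg b n ((1 / (2 * b : ℝ)) • ((fun _ => 1) -
      fun k => if spread n k ≤ 1 / (2 * b) then 1 else 0)) ≤ urnAvg b n (spread n) := by
    refine urnAvg_mono (by omega) n fun k hk => ?_
    simp only [Pi.smul_apply, Pi.sub_apply, smul_eq_mul]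
    split_ifs with h
    · simpa using spread_nonneg hk
    · simpa using (not_le.1 h).le
  rw [map_smul, map_sub, urnAvg_const (by omega), smul_eq_mul] at h2
  refine le_trans ?_ h2
  have h3 : (b : ℝ) * (1 / (2 * b)) = 1 / 2 := by field_simp
  rw [h3] at h
  have h4 : 1 / (4 * b : ℝ) = 1 / (2 * b) * (1 / 2) := by field_simp; norm_num
  rw [h4]
  gcongr
  linarith

/-! ### The contraction estimate -/

lemma one_sub_exp_neg_ge {y : ℝ} (hy : 0 ≤ y) : min y 1 / 2 ≤ 1 - Real.exp (-y) := by
  have h1 : Real.exp (-y) ≤ 1 / (1 + y) := by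
    rw [Real.exp_neg, ← one_div]
    exact one_div_le_one_div_of_le (by linarith) (by linarith [Real.add_one_le_exp y])
  have h2 : 1 - 1 / (1 + y) = y / (1 + y) := by field_simp; ring
  have h3 : min y 1 / 2 ≤ y / (1 + y) := by
    rw [div_le_div_iff₀ (by norm_num) (by linarith)]
    rcases le_total y 1 with h | h
    · rw [min_eq_left h]; nlinarith
    · rw [min_eq_right h]; linarith
  linarith

/-- The contraction estimate: a centered toll of size `c * σ` is compensated by the spread of the
branch sizes. -/
lemma urnAvg_mul_exp_neg_spread_le_one (hb : 2 ≤ b) (n : ℕ) {c σ A : ℝ} (hc : 0 < c) (hσ : 0 ≤ σ)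
    (hA : 128 * b ^ 3 * c ^ 2 ≤ A) {F τ : (Fin b → ℕ) → ℝ} (hτ : urnAvg b n τ = 0)
    (hlo : ∀ k, ∑ i, k i = n → Real.exp (-(c * σ)) ≤ F k)
    (hhi : ∀ k, ∑ i, k i = n → F k ≤ Real.exp (c * σ))
    (hF : ∀ k, ∑ i, k i = n → F k ≤ 1 + τ k + c ^ 2 * σ ^ 2 * Real.exp (c * σ)) :
    urnAvg b n (fun k => F k * Real.exp (-(A * σ ^ 2 * Real.exp (2 * c * σ) * spread n k))) ≤ 1 := by
  classical
  have hb' : (2 : ℝ) ≤ b := by exact_mod_cast hb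
  have hA0 : 0 < A := lt_of_lt_of_le (by positivity) hA
  -- For small scales the linear term `τ` averages out and the mean spread pays for the quadratic
  -- remainder. For large scales no cancellation is used, only that the spread is rarely tiny.
  rcases le_total (c * σ) (1 / (8 * b)) with hs | hs
  · set B := c ^ 2 * σ ^ 2 * Real.exp (c * σ) with hB
    set w := Real.exp (-(c * σ)) * (min (A * σ ^ 2) 1 / 2) with hw
    have hw0 : 0 ≤ w := by positivity
    calc _ ≤ urnAvg b n ((fun _ => 1 + B) + τ - w • spread n) := by
          refine urnAvg_mono (by omega) n fun k hk => ?_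
          simp only [Pi.add_apply, Pi.sub_apply, Pi.smul_apply, smul_eq_mul]
          set y := A * σ ^ 2 * Real.exp (2 * c * σ) * spread n k with hy
          have hsp := spread_nonneg hk
          have hsp1 := spread_le_one n k
          have hy1 : A * σ ^ 2 * spread n k ≤ y := by
            refine mul_le_mul_of_nonneg_right ?_ hsp
            exact le_mul_of_one_le_right (by positivity) (Real.one_le_exp (by positivity))
          have hy0 : 0 ≤ y := by positivity
          have h1 := one_sub_exp_neg_ge hy0
          have h2 : min (A * σ ^ 2) 1 * spread n k ≤ min y 1 := by
            refine le_min ?_ ?_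
            · exact le_trans (mul_le_mul_of_nonneg_right (min_le_left _ _) hsp) hy1
            · have : min (A * σ ^ 2) 1 ≤ 1 := min_le_right _ _
              have h0 : 0 ≤ min (A * σ ^ 2) 1 := by positivity
              nlinarith
          have h3 : w * spread n k ≤ F k * (1 - Real.exp (-y)) := by
            calc w * spread n k = Real.exp (-(c * σ)) * (min (A * σ ^ 2) 1 * spread n k / 2) := by
                  rw [hw]; ring
              _ ≤ F k * (1 - Real.exp (-y)) := by
                  refine mul_le_mul (hlo k hk) (by linarith) (by positivity) ?_
                  exact (Real.exp_pos _).le.trans (hlo k hk)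
          have h4 := hF k hk
          linarith
      _ = 1 + B - w * urnAvg b n (spread n) := by
          rw [map_sub, map_add, map_smul, urnAvg_const (by omega), hτ, smul_eq_mul, add_zero]
      _ ≤ 1 := by
          have h1 := mul_le_mul_of_nonneg_left (le_urnAvg_spread hb n) hw0
          suffices B ≤ w * (1 / (4 * b)) by linarith
          have hcσ : c * σ ≤ 1 / 16 := hs.trans (by
            rw [div_le_div_iff₀ (by positivity) (by norm_num)]; linarith)
          have he : Real.exp (c * σ) * Real.exp (c * σ) ≤ 8 := by
            rw [← Real.exp_add]
            calc Real.exp (c * σ + c * σ) ≤ Real.exp 1 := Real.exp_le_exp.2 (by linarith)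
              _ ≤ 8 := by linarith [Real.exp_one_lt_d9]
          have hmin : 64 * b * (c * σ) ^ 2 ≤ min (A * σ ^ 2) 1 := by
            refine le_min ?_ ?_
            · have h64 : 64 * (b : ℝ) * c ^ 2 ≤ A := by
                refine le_trans ?_ hA
                have : (b : ℝ) ≤ b ^ 3 := le_self_pow₀ (by linarith) (by norm_num)
                gcongr
                norm_num
              calc 64 * b * (c * σ) ^ 2 = 64 * b * c ^ 2 * σ ^ 2 := by ring
                _ ≤ _ := by gcongr
            · calc 64 * (b : ℝ) * (c * σ) ^ 2 ≤ 64 * (b : ℝ) * (1 / (8 * b)) ^ 2 := by gcongr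
                _ = 1 / (b : ℝ) := by field_simp; norm_num
                _ ≤ 1 := by rw [div_le_one (by linarith)]; linarith
          have hexp : Real.exp (c * σ) * Real.exp (-(c * σ)) = 1 := by
            rw [← Real.exp_add]; simp
          have hkey : B ≤ Real.exp (-(c * σ)) * (64 * b * (c * σ) ^ 2 / 2) * (1 / (4 * b)) := by
            have h5 : Real.exp (-(c * σ)) * (64 * b * (c * σ) ^ 2 / 2) * (1 / (4 * b)) =
                8 * (c * σ) ^ 2 * Real.exp (-(c * σ)) := by field_simp; ring
            rw [h5, hB]
            have h6 : Real.exp (c * σ) ≤ 8 * Real.exp (-(c * σ)) := by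
              have := mul_le_mul_of_nonneg_right he (Real.exp_pos (-(c * σ))).le
              rwa [mul_assoc, hexp, mul_one] at this
            nlinarith [sq_nonneg (c * σ)]
          refine hkey.trans ?_
          rw [hw]
          gcongr
  -- With this `δ` the event of spread at most `δ` contributes at most `1 / 2`, although `F` may be
  -- as large as `exp (c * σ)`. Off that event, of the factor `exp (2 * c * σ)` one half cancels `δ`
  -- and the other dominates `1 + c * σ`, leaving `exp (-1)`.
  · set δ := Real.exp (-(c * σ)) / (2 * b) with hδ
    have hδ0 : 0 < δ := by positivity
    set E := A * σ ^ 2 * Real.exp (2 * c * σ) with hE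
    have hE0 : 0 ≤ E := by positivity
    calc _ ≤ urnAvg b n (Real.exp (c * σ) • ((fun k => if spread n k ≤ δ then 1 else 0) +
            fun _ => Real.exp (-(E * δ)))) := by
          refine urnAvg_mono (by omega) n fun k hk => ?_
          simp only [Pi.add_apply, Pi.smul_apply, smul_eq_mul]
          refine mul_le_mul (hhi k hk) ?_ (Real.exp_pos _).le (Real.exp_pos _).le
          have hsp := spread_nonneg hk
          split_ifs with h
          · have : Real.exp (-(E * spread n k)) ≤ 1 := by
              rw [Real.exp_le_one_iff]
              have := mul_nonneg hE0 hsp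
              linarith
            linarith [Real.exp_pos (-(E * δ))]
          · rw [zero_add, Real.exp_le_exp]
            have := mul_le_mul_of_nonneg_left (not_le.1 h).le hE0
            linarith
      _ = Real.exp (c * σ) * (urnAvg b n (fun k => if spread n k ≤ δ then 1 else 0) +
            Real.exp (-(E * δ))) := by
          rw [map_smul, map_add, urnAvg_const (by omega), smul_eq_mul]
      _ ≤ Real.exp (c * σ) * (b * δ + Real.exp (-(1 + c * σ))) := by
          gcongr
          · exact urnAvg_spread_le hb n hδ0.le
          · have h1 : E * δ = A * σ ^ 2 / (2 * b) * Real.exp (c * σ) := by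
              have : Real.exp (2 * c * σ) = Real.exp (c * σ) * Real.exp (c * σ) := by
                rw [← Real.exp_add]; ring_nf
              rw [hE, hδ, this, Real.exp_neg]
              field_simp
            -- The constant `128 * b ^ 3` is what the threshold `c * σ ≥ 1 / (8 * b)` requires here.
            have h2 : 1 ≤ A * σ ^ 2 / (2 * b) := by
              rw [le_div_iff₀ (by positivity)]
              calc 1 * (2 * (b : ℝ)) = 128 * b ^ 3 * (1 / (8 * b)) ^ 2 := by field_simp; norm_num
                _ ≤ 128 * b ^ 3 * (c * σ) ^ 2 := by gcongr
                _ = 128 * b ^ 3 * c ^ 2 * σ ^ 2 := by ring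
                _ ≤ _ := by gcongr
            rw [h1]
            have h3 := Real.add_one_le_exp (c * σ)
            nlinarith [Real.exp_pos (c * σ)]
      _ = 1 / 2 + Real.exp (-1) := by
          have h1 : Real.exp (c * σ) * (b * δ) = 1 / 2 := by
            rw [hδ, Real.exp_neg]; field_simp
          rw [mul_add, h1, ← Real.exp_add]
          ring_nf
      _ ≤ 1 := by
          have : Real.exp (-1) ≤ 1 / 2 := by
            rw [Real.exp_neg, ← one_div]
            apply one_div_le_one_div_of_le (by norm_num)
            linarith [Real.add_one_le_exp (1 : ℝ)]
          linarith

/-! ### Asymptotics and splitting of the means -/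

lemma meanToll_nonneg {c : ℕ → ℝ} (hc : ∀ k, 0 ≤ c k) (n : ℕ) : 0 ≤ meanToll b c n := by
  have h := treeAvg_mono (b := b) n (f := 0) (g := toll c) (fun S _ _ =>
    Finset.sum_nonneg fun u _ => Finset.sum_nonneg fun i _ => hc _)
  rwa [map_zero] at h

/-- A toll without constant term that is quadratic in the size. -/
def quad (p q : ℝ) (k : ℕ) : ℝ := p * k + q * (k : ℝ) ^ 2

lemma meanToll_quad (p q : ℝ) (n : ℕ) : meanToll b (quad p q) n =
    p * meanToll b (fun k => (k : ℝ)) n + q * meanToll b (fun k => (k : ℝ) ^ 2) n := by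
  have : toll (b := b) (quad p q) = p • toll (fun k => (k : ℝ)) + q • toll (fun k => (k : ℝ) ^ 2) := by
    ext S
    simp only [toll, quad, Pi.add_apply, Pi.smul_apply, smul_eq_mul, Finset.mul_sum,
      Finset.sum_add_distrib]
  rw [meanToll, this, map_add, map_smul, map_smul]
  rfl

/-- Here the last node is removed rather than the root: it adds its depth, and the average depth of
an external node is a function of the path length and the size. The recursion is therefore closed
and linear. -/
lemma meanToll_id_succ (hb : 1 ≤ b) (n : ℕ) : meanToll b (fun k => (k : ℝ)) (n + 1) =
    meanToll b (fun k => (k : ℝ)) n +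
      ((b - 1) * meanToll b (fun k => (k : ℝ)) n + b * n) / ((b - 1) * n + 1) := by
  rw [meanToll, treeAvg_succ, treeAvg_congr n (g := toll (fun k => (k : ℝ)) +
    (((b : ℝ) - 1) * n + 1)⁻¹ • (((b : ℝ) - 1) • toll (fun k => (k : ℝ)) + fun _ => (b : ℝ) * n))]
  · rw [map_add, map_smul, map_add, map_smul, treeAvg_const hb, smul_eq_mul, smul_eq_mul,
      inv_mul_eq_div]
    rfl
  · intro S hS hc
    have hpos := card_external_pos hb hS
    have h1 : ∀ v ∈ external S, toll (fun k => (k : ℝ)) (insert v S) =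
        v.length + toll (fun k => (k : ℝ)) S := by
      intro v hv
      rw [toll_id (hS.insert hv), toll_id hS, Finset.sum_insert (not_mem_of_mem_external hv)]
    rw [growAvg_apply, Finset.sum_congr rfl h1, Finset.sum_add_distrib, Finset.sum_const,
      sum_length_external hS]
    simp only [Pi.add_apply, Pi.smul_apply, smul_eq_mul, nsmul_eq_mul]
    rw [← toll_id hS, ← hc, ← card_external hS]
    field_simp
    ring

lemma abs_harmonic_sub_log_le {n : ℕ} (hn : 1 ≤ n) : |(harmonic n : ℝ) - Real.log n| ≤ 1 := by
  have h1 := harmonic_le_one_add_log n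
  have h2 := log_add_one_le_harmonic n
  have h3 : Real.log n ≤ Real.log ((n + 1 : ℕ) : ℝ) :=
    Real.log_le_log (by exact_mod_cast hn) (by push_cast; linarith)
  rw [abs_le]
  constructor <;> linarith

/-- The mean unweighted path length is asymptotic to `b / (b - 1) * n * log n`, up to `O(n)`. -/
lemma exists_abs_meanToll_id_sub_le (hb : 2 ≤ b) : ∃ K : ℝ, 0 ≤ K ∧ ∀ n : ℕ,
    |meanToll b (fun k => (k : ℝ)) n - b / (b - 1) * (n * Real.log n)| ≤ K * n := by
  have hb' : (2 : ℝ) ≤ b := by exact_mod_cast hb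
  set β : ℝ := (b : ℝ) - 1 with hβ
  have hβ1 : 1 ≤ β := by rw [hβ]; linarith
  set κ : ℝ := b / β ^ 2 with hκ
  have hκ0 : 0 ≤ κ := by positivity
  -- Dividing by the number of external nodes removes the multiplicative factor of the recursion, so
  -- that the increments of `y` are explicit and close to `κ / (n + 1)`.
  set y : ℕ → ℝ := fun n => meanToll b (fun k => (k : ℝ)) n / (β * n + 1) with hy
  have hy0 : y 0 = 0 := by simp [hy, meanToll_zero]
  have hynn : ∀ n, 0 ≤ y n := fun n =>
    div_nonneg (meanToll_nonneg (fun k => k.cast_nonneg) n) (by positivity)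
  have hys : ∀ n : ℕ, y (n + 1) = y n + b * n / ((β * n + 1) * (β * (n + 1) + 1)) := by
    intro n
    have hn : (0 : ℝ) ≤ n := n.cast_nonneg
    have h1 : 0 < β * n + 1 := by positivity
    have h2 : 0 < β * (n + 1) + 1 := by positivity
    simp only [hy]
    rw [meanToll_id_succ (by omega), ← hβ]
    push_cast
    field_simp
    ring
  have hup : ∀ n : ℕ, y n ≤ κ * harmonic n := by
    intro n
    induction n with
    | zero => simp [hy0]
    | succ n ih =>
      rw [hys, harmonic_succ]
      push_cast
      rw [mul_add κ]
      refine add_le_add ih ?_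
      have hn : (0 : ℝ) ≤ n := n.cast_nonneg
      rw [← div_eq_mul_inv, hκ, div_div, div_le_div_iff₀ (by positivity) (by positivity)]
      have : n * (β ^ 2 * (n + 1)) ≤ (β * n + 1) * (β * (n + 1) + 1) := by nlinarith
      calc (b : ℝ) * n * (β ^ 2 * (n + 1)) = b * (n * (β ^ 2 * (n + 1))) := by ring
        _ ≤ _ := by gcongr
  -- The increments fall short of `κ / (n + 1)` by at most `κ * (b + 1) / ((n + 1) * (n + 2))`,
  -- which telescopes to the subtracted term.
  have hlo : ∀ n : ℕ, κ * harmonic n - κ * (b + 1) * (1 - 1 / (n + 1)) ≤ y n := by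
    intro n
    induction n with
    | zero => simp [hy0]
    | succ n ih =>
      rw [hys, harmonic_succ]
      push_cast
      have hn : (0 : ℝ) ≤ n := n.cast_nonneg
      have key : κ / (n + 1) - κ * (b + 1) * (1 / (n + 1) - 1 / (n + 1 + 1)) ≤
          b * n / ((β * n + 1) * (β * (n + 1) + 1)) := by
        have hb2 : (b : ℝ) = κ * β ^ 2 := by rw [hκ]; field_simp
        have e1 : κ / (n + 1) - b * n / ((β * n + 1) * (β * (n + 1) + 1)) =
            κ * (2 * β * n + β + 1) / ((n + 1) * ((β * n + 1) * (β * (n + 1) + 1))) := by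
          rw [hb2]; field_simp; ring
        have e2 : κ * (b + 1) * (1 / (n + 1) - 1 / (n + 1 + 1)) =
            κ * (b + 1) / ((n + 1) * (n + 2)) := by
          field_simp; ring
        have e3 : κ * (2 * β * n + β + 1) / ((n + 1) * ((β * n + 1) * (β * (n + 1) + 1))) ≤
            κ * (b + 1) / ((n + 1) * (n + 2)) := by
          have hbβ : (b : ℝ) = β + 1 := by rw [hβ]; ring
          rw [div_le_div_iff₀ (by positivity) (by positivity), hbβ]
          have e4 : 2 * β * n + β + 1 ≤ (β + 2) * (β * n + 1) := by nlinarith [mul_nonneg (by linarith : 0 ≤ β) hn]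
          have e5 : (n : ℝ) + 2 ≤ β * (n + 1) + 1 := by nlinarith
          calc κ * (2 * β * n + β + 1) * ((n + 1) * (n + 2))
              ≤ κ * ((β + 2) * (β * n + 1)) * ((n + 1) * (β * (n + 1) + 1)) := by gcongr
            _ = _ := by ring
        linarith
      rw [mul_add, ← div_eq_mul_inv]
      nlinarith
  refine ⟨κ * (b + 2) * β + κ, by positivity, fun n => ?_⟩
  rcases Nat.eq_zero_or_pos n with rfl | hn
  · simp [meanToll_zero]
  have hn1 : (1 : ℝ) ≤ n := by exact_mod_cast hn
  have h1 := abs_le.1 (abs_harmonic_sub_log_le hn)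
  have h2 : |y n - κ * Real.log n| ≤ κ * (b + 2) := by
    have h3 : 1 - 1 / ((n : ℝ) + 1) ≤ 1 := by
      have : 0 ≤ 1 / ((n : ℝ) + 1) := by positivity
      linarith
    have h4 : κ * (b + 1) * (1 - 1 / ((n : ℝ) + 1)) ≤ κ * (b + 1) :=
      mul_le_of_le_one_right (by positivity) h3
    have h5 := hlo n
    have h6 := hup n
    have h7 := mul_le_mul_of_nonneg_left h1.1 hκ0
    have h8 := mul_le_mul_of_nonneg_left h1.2 hκ0
    have h9 : 0 ≤ κ * b := by positivity
    rw [abs_le]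
    constructor <;> linarith
  have h3 : y n ≤ κ * n := by
    refine (hup n).trans (mul_le_mul_of_nonneg_left ?_ hκ0)
    have := Real.log_le_sub_one_of_pos (by linarith : (0 : ℝ) < n)
    linarith
  have h4 : meanToll b (fun k => (k : ℝ)) n - b / β * (n * Real.log n) =
      β * n * (y n - κ * Real.log n) + y n := by
    have : meanToll b (fun k => (k : ℝ)) n = y n * (β * n + 1) := by
      simp only [hy]; field_simp
    rw [this, hκ]
    field_simp
    ring
  rw [h4]
  calc _ ≤ |β * n * (y n - κ * Real.log n)| + |y n| := abs_add_le _ _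
    _ = β * n * |y n - κ * Real.log n| + y n := by
        rw [abs_mul, abs_of_nonneg (by positivity : 0 ≤ β * n), abs_of_nonneg (hynn n)]
    _ ≤ β * n * (κ * (b + 2)) + κ * n := by gcongr
    _ = _ := by ring

/-- An entropy bound: each loss `k * log (N / k)` is at most `N`, by `log x ≤ x - 1`. -/
lemma abs_sum_mul_log_sub_le {n : ℕ} {k : Fin b → ℕ} (hk : ∑ i, k i = n) :
    |∑ i, (k i : ℝ) * Real.log (k i) - ((n + 1 : ℕ) : ℝ) * Real.log (n + 1 : ℕ)| ≤
      (b + 1) * (n + 1 : ℕ) := by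
  set N : ℝ := ((n + 1 : ℕ) : ℝ) with hN
  have hN1 : 1 ≤ N := by rw [hN]; push_cast; linarith [n.cast_nonneg (α := ℝ)]
  have hlog : 0 ≤ Real.log N := Real.log_nonneg hN1
  have hkN : ∀ i, (k i : ℝ) ≤ N := fun i => by
    have : k i ≤ n := hk ▸ Finset.single_le_sum (fun _ _ => Nat.zero_le _) (Finset.mem_univ i)
    rw [hN]; exact_mod_cast (by omega : k i ≤ n + 1)
  have hsum : ∑ i, (k i : ℝ) * Real.log N = (N - 1) * Real.log N := by
    rw [← Finset.sum_mul, ← Nat.cast_sum, hk, hN]; push_cast; ring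
  have h1 : ∀ i, (k i : ℝ) * Real.log N - N ≤ k i * Real.log (k i) ∧
      k i * Real.log (k i) ≤ k i * Real.log N := by
    intro i
    rcases Nat.eq_zero_or_pos (k i) with h | h
    · rw [h]; simp; linarith
    · have hp : (0 : ℝ) < k i := by exact_mod_cast h
      refine ⟨?_, by gcongr; exact hkN i⟩
      have := Real.log_le_sub_one_of_pos (div_pos (by linarith : 0 < N) hp)
      rw [Real.log_div (by linarith) hp.ne'] at this
      have h2 := mul_le_mul_of_nonneg_left this hp.le
      have h3 : (k i : ℝ) * (N / k i - 1) = N - k i := by field_simp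
      rw [h3] at h2
      linarith
  have h2 := Finset.sum_le_sum fun i (_ : i ∈ Finset.univ) => (h1 i).1
  have h3 := Finset.sum_le_sum fun i (_ : i ∈ Finset.univ) => (h1 i).2
  rw [Finset.sum_sub_distrib, hsum] at h2
  rw [hsum] at h3
  simp only [Finset.sum_const, Finset.card_univ, Fintype.card_fin, nsmul_eq_mul] at h2
  have h4 := Real.log_le_sub_one_of_pos (by linarith : 0 < N)
  have h5 : 0 ≤ (b : ℝ) * N := by positivity
  rw [abs_le]
  constructor <;> linarith

/-- This keeps the centred root contribution of the order of the scale, without a logarithm. -/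
lemma exists_abs_sum_meanToll_id_sub_le (hb : 2 ≤ b) : ∃ C : ℝ, 0 ≤ C ∧
    ∀ (n : ℕ) (k : Fin b → ℕ), ∑ i, k i = n →
      |∑ i, meanToll b (fun k => (k : ℝ)) (k i) - meanToll b (fun k => (k : ℝ)) (n + 1)| ≤
        C * (n + 1 : ℕ) := by
  have hb' : (2 : ℝ) ≤ b := by exact_mod_cast hb
  obtain ⟨K, hK0, hK⟩ := exists_abs_meanToll_id_sub_le hb
  have hκ : (0 : ℝ) ≤ b / (b - 1) := div_nonneg (by linarith) (by linarith)
  refine ⟨K + b / (b - 1) * (b + 1) + K, by positivity, fun n k hk => ?_⟩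
  set f := meanToll b (fun k => (k : ℝ))
  set κ := (b : ℝ) / (b - 1)
  have h1 : |∑ i, (f (k i) - κ * (k i * Real.log (k i)))| ≤ K * (n + 1 : ℕ) := by
    refine (Finset.abs_sum_le_sum_abs _ _).trans ((Finset.sum_le_sum fun i _ => hK (k i)).trans ?_)
    rw [← Finset.mul_sum, ← Nat.cast_sum, hk]
    gcongr
    omega
  have h2 := abs_le.1 (hK (n + 1))
  have h3 := abs_le.1 (abs_sum_mul_log_sub_le hk)
  rw [Finset.sum_sub_distrib, ← Finset.mul_sum] at h1
  have h1' := abs_le.1 h1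
  have h4 := mul_le_mul_of_nonneg_left h3.1 hκ
  have h5 := mul_le_mul_of_nonneg_left h3.2 hκ
  rw [abs_le]
  constructor <;> linarith

lemma sum_sq_eq (n : ℕ) (k : Fin b → ℕ) :
    ∑ i, (k i : ℝ) ^ 2 = (1 - spread n k) * ((n + 1 : ℕ) : ℝ) ^ 2 := by
  have : ((n + 1 : ℕ) : ℝ) ≠ 0 := by positivity
  rw [spread, sub_sub_cancel, Finset.sum_mul]
  refine Finset.sum_congr rfl fun i _ => ?_
  push_cast at this ⊢
  field_simp

/-- Splitting shrinks the sum of squares by the mean factor `1 - 1 / (4 * b)` at most, and `(1 + 4 *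
b) * (1 - 1 / (4 * b)) ≤ 4 * b` closes the induction. -/
lemma meanToll_sq_le (hb : 2 ≤ b) (n : ℕ) :
    meanToll b (fun k => (k : ℝ) ^ 2) n ≤ 4 * b * (n : ℝ) ^ 2 := by
  have hb' : (2 : ℝ) ≤ b := by exact_mod_cast hb
  induction n using Nat.strong_induction_on with
  | _ n ih =>
  cases n with
  | zero => simp [meanToll_zero]
  | succ n =>
    rw [meanToll_succ (by omega)]
    calc _ ≤ urnAvg b n (((1 + 4 * b) * ((n + 1 : ℕ) : ℝ) ^ 2) • ((fun _ => 1) - spread n)) := by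
          refine urnAvg_mono (by omega) n fun k hk => ?_
          have h1 : ∀ i ∈ Finset.univ, (k i : ℝ) ^ 2 + meanToll b (fun k => (k : ℝ) ^ 2) (k i) ≤
              (1 + 4 * b) * (k i : ℝ) ^ 2 := by
            intro i _
            have : k i ≤ n := hk ▸ Finset.single_le_sum (fun _ _ => Nat.zero_le _)
              (Finset.mem_univ i)
            linarith [ih (k i) (by omega)]
          refine (Finset.sum_le_sum h1).trans ?_
          rw [← Finset.mul_sum, sum_sq_eq n k]
          simp only [Pi.smul_apply, Pi.sub_apply, smul_eq_mul]
          apply le_of_eq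
          ring
      _ = (1 + 4 * b) * ((n + 1 : ℕ) : ℝ) ^ 2 * (1 - urnAvg b n (spread n)) := by
          rw [map_smul, map_sub, urnAvg_const (by omega), smul_eq_mul]
      _ ≤ (1 + 4 * b) * ((n + 1 : ℕ) : ℝ) ^ 2 * (1 - 1 / (4 * b)) := by
          gcongr
          exact le_urnAvg_spread hb n
      _ = (4 * b - 1 / (4 * b)) * ((n + 1 : ℕ) : ℝ) ^ 2 := by field_simp; ring
      _ ≤ _ := by
          gcongr
          have : 0 ≤ 1 / (4 * b : ℝ) := by positivity
          linarith

lemma abs_sum_meanToll_sq_sub_le (hb : 2 ≤ b) {n : ℕ} {k : Fin b → ℕ} (hk : ∑ i, k i = n) :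
    |∑ i, meanToll b (fun k => (k : ℝ) ^ 2) (k i) - meanToll b (fun k => (k : ℝ) ^ 2) (n + 1)| ≤
      4 * b * ((n + 1 : ℕ) : ℝ) ^ 2 := by
  have h0 := fun n => meanToll_nonneg (b := b) (c := fun k => (k : ℝ) ^ 2) (fun k => sq_nonneg _) n
  have h1 := meanToll_sq_le hb (n + 1)
  have h2 : ∑ i, meanToll b (fun k => (k : ℝ) ^ 2) (k i) ≤ 4 * b * ((n + 1 : ℕ) : ℝ) ^ 2 := by
    refine (Finset.sum_le_sum fun i _ => meanToll_sq_le hb (k i)).trans ?_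
    rw [← Finset.mul_sum, sum_sq_eq n k]
    gcongr
    exact mul_le_of_le_one_left (by positivity) (by linarith [spread_nonneg hk])
  have h3 := Finset.sum_nonneg fun i (_ : i ∈ Finset.univ) => h0 (k i)
  have h4 := h0 (n + 1)
  rw [abs_le]
  constructor <;> linarith

/-! ### Exponential moments given the tree -/

lemma exp_le_of_abs_le {x y : ℝ} (h : |x| ≤ y) : Real.exp x ≤ 1 + x + y ^ 2 * Real.exp y := by
  have hy : 0 ≤ y := (abs_nonneg x).trans h
  have hx := abs_le.1 h
  have hey : 1 ≤ Real.exp y := Real.one_le_exp hy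
  by_cases h1 : |x| ≤ 1
  · have h2 := (abs_le.1 (Real.abs_exp_sub_one_sub_id_le h1)).2
    have h3 : x ^ 2 ≤ y ^ 2 := by rw [← sq_abs]; gcongr
    nlinarith [sq_nonneg y]
  · have hy1 : 1 < y := (not_le.1 h1).trans_le h
    have hey2 := Real.add_one_le_exp y
    rcases le_total 0 x with hx0 | hx0
    · have : Real.exp x ≤ Real.exp y := Real.exp_le_exp.2 hx.2
      have h2 : Real.exp y ≤ y ^ 2 * Real.exp y :=
        le_mul_of_one_le_left (by linarith) (one_le_pow₀ hy1.le)
      linarith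
    · have : Real.exp x ≤ 1 := Real.exp_le_one_iff.2 hx0
      nlinarith

/-- Moment generating function of a random vector. -/
noncomputable def vecMgf (ν : Measure (Fin b → ℝ)) (c : Fin b → ℝ) : ℝ :=
  ∫ z, Real.exp (∑ i, z i * c i) ∂ν

/-- Conditional exponential moment of the weighted toll given the tree. -/
noncomputable def treeMgf (ν : Measure (Fin b → ℝ)) (c : ℕ → ℝ) (S : Tree b) : ℝ :=
  ∏ u ∈ S, vecMgf ν (fun i => c (size S (u ++ [i])))

lemma vecMgf_nonneg (ν : Measure (Fin b → ℝ)) (c : Fin b → ℝ) : 0 ≤ vecMgf ν c :=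
  integral_nonneg fun _ => (Real.exp_pos _).le

lemma treeMgf_nonneg (ν : Measure (Fin b → ℝ)) (c : ℕ → ℝ) (S : Tree b) : 0 ≤ treeMgf ν c S :=
  Finset.prod_nonneg fun _ _ => vecMgf_nonneg _ _

lemma treeMgf_eq (ν : Measure (Fin b → ℝ)) (c : ℕ → ℝ) {S : Tree b} (hS : [] ∈ S) :
    treeMgf ν c S =
      vecMgf ν (fun i => c (branch i S).card) * ∏ i, treeMgf ν c (branch i S) := by
  rw [treeMgf, prod_eq_mul_prod_branch hS]
  simp [size_cons, size_nil, treeMgf]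

lemma treeAvg_treeMgf_succ (hb : 1 ≤ b) (ν : Measure (Fin b → ℝ)) (c : ℕ → ℝ) (n : ℕ) :
    treeAvg b (n + 1) (treeMgf ν c) =
      urnAvg b n (fun k => vecMgf ν (fun i => c (k i)) * ∏ i, treeAvg b (k i) (treeMgf ν c)) := by
  rw [← treeAvg_branches hb n (fun k => vecMgf ν fun i => c (k i)) (fun _ => treeMgf ν c)]
  exact treeAvg_congr _ fun S hS hc =>
    treeMgf_eq ν c (hS.nil_mem (Finset.card_pos.1 (by omega)))

lemma integrable_apply_of_bounded {ν : Measure (Fin b → ℝ)} [IsProbabilityMeasure ν] {M : ℝ}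
    (hz : ∀ᵐ z ∂ν, ∀ i, 0 ≤ z i ∧ z i ≤ M) (i : Fin b) : Integrable (fun z => z i) ν := by
  refine Integrable.of_bound (C := M) (measurable_pi_apply i).aestronglyMeasurable ?_
  filter_upwards [hz] with z h
  rw [Real.norm_of_nonneg (h i).1]
  exact (h i).2

section

variable {ν : Measure (Fin b → ℝ)} [IsProbabilityMeasure ν] {X : (Fin b → ℝ) → ℝ} {y : ℝ}

lemma integrable_exp_of_abs_le (hX : Measurable X) (h : ∀ᵐ z ∂ν, |X z| ≤ y) :
    Integrable (fun z => Real.exp (X z)) ν := by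
  refine Integrable.of_bound (C := Real.exp y) hX.exp.aestronglyMeasurable ?_
  filter_upwards [h] with z hz
  rw [Real.norm_of_nonneg (Real.exp_pos _).le, Real.exp_le_exp]
  exact (abs_le.1 hz).2

lemma integral_exp_le_exp (hX : Measurable X) (h : ∀ᵐ z ∂ν, |X z| ≤ y) :
    ∫ z, Real.exp (X z) ∂ν ≤ Real.exp y := by
  have := integral_mono_ae (integrable_exp_of_abs_le hX h) (integrable_const (Real.exp y))
    (by filter_upwards [h] with z hz using Real.exp_le_exp.2 (abs_le.1 hz).2)
  simpa using this

lemma exp_neg_le_integral_exp (hX : Measurable X) (h : ∀ᵐ z ∂ν, |X z| ≤ y) :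
    Real.exp (-y) ≤ ∫ z, Real.exp (X z) ∂ν := by
  have := integral_mono_ae (integrable_const (Real.exp (-y))) (integrable_exp_of_abs_le hX h)
    (by filter_upwards [h] with z hz using Real.exp_le_exp.2 (abs_le.1 hz).1)
  simpa using this

lemma integral_exp_le_one_add (hX : Measurable X) (h : ∀ᵐ z ∂ν, |X z| ≤ y) :
    ∫ z, Real.exp (X z) ∂ν ≤ 1 + ∫ z, X z ∂ν + y ^ 2 * Real.exp y := by
  have hi : Integrable X ν := Integrable.of_bound (C := y) hX.aestronglyMeasurable h
  have := integral_mono_ae (integrable_exp_of_abs_le hX h)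
    (((integrable_const (1 : ℝ)).add hi).add (integrable_const (y ^ 2 * Real.exp y)))
    (by filter_upwards [h] with z hz using exp_le_of_abs_le hz)
  simp only [Pi.add_apply] at this
  have h1 : Integrable (fun z => 1 + X z) ν := (integrable_const (1 : ℝ)).add hi
  rw [integral_add h1 (integrable_const _), integral_add (integrable_const _) hi] at this
  simpa using this

end

/-! ### The exponential moment bound -/

/-- Scale of the toll `quad p q` on trees of size `n`. -/
noncomputable def scale (p q : ℝ) (n : ℕ) : ℝ := |p| * n + |q| * (n : ℝ) ^ 2

lemma scale_nonneg (p q : ℝ) (n : ℕ) : 0 ≤ scale p q n := by unfold scale; positivity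

/-- The linear part of the scale is inherited in proportion to the branch size, the quadratic part
even less. Squaring therefore yields the squared fractions that the spread measures. -/
lemma scale_le (p q : ℝ) {n : ℕ} {k : Fin b → ℕ} (hk : ∑ i, k i = n) (i : Fin b) :
    scale p q (k i) ≤ (k i : ℝ) / (n + 1) * scale p q (n + 1) := by
  have h1 := div_le_one_of_sum_eq hk i
  have hN : (0 : ℝ) < n + 1 := by positivity
  have h2 : (k i : ℝ) ≤ n + 1 := (div_le_one hN).1 h1
  have h3 : (k i : ℝ) / (n + 1) * scale p q (n + 1) = |p| * k i + |q| * (k i * (n + 1)) := by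
    rw [scale]; push_cast; field_simp
  rw [h3, scale, sq]
  gcongr

/-- Subgaussian-type bound for the exponential moments, with a variance proxy that grows
exponentially with the scale. -/
theorem exists_treeAvg_treeMgf_le (hb : 2 ≤ b) (ν : Measure (Fin b → ℝ)) [IsProbabilityMeasure ν]
    {m M : ℝ} (hz : ∀ᵐ z ∂ν, ∀ i, 0 ≤ z i ∧ z i ≤ M) (hm : ∀ i, ∫ z, z i ∂ν = m) :
    ∃ A C : ℝ, 0 < A ∧ 0 < C ∧ ∀ (p q : ℝ) (n : ℕ), treeAvg b n (treeMgf ν (quad p q)) ≤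
      Real.exp (m * meanToll b (quad p q) n +
        A * scale p q n ^ 2 * Real.exp (2 * C * scale p q n)) := by
  have hb' : (2 : ℝ) ≤ b := by exact_mod_cast hb
  obtain ⟨C₁, hC₁, hC₁'⟩ := exists_abs_sum_meanToll_id_sub_le hb
  have hm0 : 0 ≤ m := by
    rw [← hm ⟨0, by omega⟩]
    exact integral_nonneg_of_ae (by filter_upwards [hz] with z h using (h _).1)
  have hM0 : 0 ≤ M := by
    obtain ⟨z, h⟩ := hz.exists
    exact (h ⟨0, by omega⟩).1.trans (h ⟨0, by omega⟩).2
  -- `M` bounds the root toll and `m * (C₁ + 4 * b)` its centring, both relative to the scale; the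
  -- `1` keeps `C` positive in degenerate cases.
  set C := M + m * (C₁ + 4 * b) + 1 with hC
  have hC0 : 0 < C := by positivity
  refine ⟨128 * b ^ 3 * C ^ 2, C, by positivity, hC0, fun p q n => ?_⟩
  set A := 128 * (b : ℝ) ^ 3 * C ^ 2 with hA
  have hA0 : 0 < A := by positivity
  set c := quad p q with hc
  set l := meanToll b c with hl
  induction n using Nat.strong_induction_on with
  | _ n ih =>
  cases n with
  | zero =>
    rw [treeAvg_zero, treeMgf, Finset.prod_empty, hl, meanToll_zero, mul_zero, zero_add]
    exact Real.one_le_exp (by positivity)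
  | succ n =>
    set σ := scale p q (n + 1) with hσ
    have hσ0 : 0 ≤ σ := scale_nonneg _ _ _
    set d : (Fin b → ℕ) → ℝ := fun k => m * (∑ i, l (k i) - l (n + 1)) with hd
    set F : (Fin b → ℕ) → ℝ := fun k => ∫ z, Real.exp (∑ i, z i * c (k i) + d k) ∂ν with hF
    set τ : (Fin b → ℕ) → ℝ := fun k => m * ∑ i, c (k i) + d k with hτ
    have hX : ∀ k : Fin b → ℕ, Measurable fun z : Fin b → ℝ => ∑ i, z i * c (k i) + d k := by
      intro k; fun_prop
    have hbound : ∀ k : Fin b → ℕ, ∑ i, k i = n →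
        ∀ᵐ z ∂ν, |∑ i, z i * c (k i) + d k| ≤ C * σ := by
      intro k hk
      filter_upwards [hz] with z hz
      have h1 : |∑ i, z i * c (k i)| ≤ M * σ := by
        calc |∑ i, z i * c (k i)| ≤ ∑ i, |z i * c (k i)| := Finset.abs_sum_le_sum_abs _ _
          _ ≤ ∑ i, M * ((k i : ℝ) / (n + 1) * σ) := by
              refine Finset.sum_le_sum fun i _ => ?_
              rw [abs_mul, abs_of_nonneg (hz i).1]
              refine mul_le_mul (hz i).2 (le_trans ?_ (scale_le p q hk i)) (abs_nonneg _) hM0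
              rw [hc, quad, scale]
              refine (abs_add_le _ _).trans (le_of_eq ?_)
              rw [abs_mul, abs_mul, Nat.abs_cast, abs_pow, Nat.abs_cast]
          _ = M * σ * ∑ i, (k i : ℝ) / (n + 1) := by
              rw [Finset.mul_sum]
              exact Finset.sum_congr rfl fun i _ => by ring
          _ ≤ M * σ := mul_le_of_le_one_right (by positivity) (sum_div_le_one hk)
      have h2 : |d k| ≤ m * ((C₁ + 4 * b) * σ) := by
        rw [hd]
        simp only
        rw [abs_mul, abs_of_nonneg hm0]
        refine mul_le_mul_of_nonneg_left ?_ hm0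
        have h3 := hC₁' n k hk
        have h4 := abs_sum_meanToll_sq_sub_le hb hk
        set f := meanToll b (fun k => (k : ℝ))
        set g := meanToll b (fun k => (k : ℝ) ^ 2)
        have h5 : ∑ i, l (k i) - l (n + 1) =
            p * (∑ i, f (k i) - f (n + 1)) + q * (∑ i, g (k i) - g (n + 1)) := by
          simp only [hl, hc, meanToll_quad, Finset.sum_add_distrib, ← Finset.mul_sum]
          ring
        rw [h5]
        refine (abs_add_le _ _).trans ?_
        rw [abs_mul, abs_mul]
        calc _ ≤ |p| * (C₁ * (n + 1 : ℕ)) + |q| * (4 * b * ((n + 1 : ℕ) : ℝ) ^ 2) := by gcongr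
          _ ≤ (C₁ + 4 * b) * σ := by
            rw [hσ, scale]
            have e1 : 0 ≤ |p| * (4 * b * (n + 1 : ℕ)) := by positivity
            have e2 : 0 ≤ |q| * (C₁ * ((n + 1 : ℕ) : ℝ) ^ 2) := by positivity
            linarith
      calc _ ≤ |∑ i, z i * c (k i)| + |d k| := abs_add_le _ _
        _ ≤ M * σ + m * ((C₁ + 4 * b) * σ) := add_le_add h1 h2
        _ ≤ C * σ := by rw [hC]; linarith
    -- The recursion for the mean toll says exactly that the centred root contribution has mean
    -- zero.
    have hτ0 : urnAvg b n τ = 0 := by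
      have h1 : τ = m • (fun k => ∑ i, (c (k i) + l (k i))) - fun _ => m * l (n + 1) := by
        ext k
        simp only [hτ, hd, Pi.sub_apply, Pi.smul_apply, smul_eq_mul, Finset.sum_add_distrib]
        ring
      rw [h1, map_sub, map_smul, urnAvg_const (by omega), smul_eq_mul, hl,
        ← meanToll_succ (by omega), sub_self]
    have hmain := urnAvg_mul_exp_neg_spread_le_one hb n hC0 hσ0 le_rfl (F := F) hτ0
      (fun k hk => exp_neg_le_integral_exp (hX k) (hbound k hk))
      (fun k hk => integral_exp_le_exp (hX k) (hbound k hk))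
      (fun k hk => by
        have h := integral_exp_le_one_add (hX k) (hbound k hk)
        have hi : ∀ i ∈ Finset.univ, Integrable (fun z : Fin b → ℝ => z i * c (k i)) ν :=
          fun i _ => (integrable_apply_of_bounded hz i).mul_const _
        rw [integral_add (integrable_finsetSum _ hi) (integrable_const _),
          integral_finsetSum _ hi] at h
        simp only [integral_mul_const, hm, integral_const, probReal_univ, one_smul] at h
        rw [← Finset.mul_sum, mul_pow] at h
        exact h)
    rw [treeAvg_treeMgf_succ (by omega)]
    set G := Real.exp (m * l (n + 1) + A * σ ^ 2 * Real.exp (2 * C * σ)) with hG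
    calc _ ≤ urnAvg b n (G • fun k =>
          F k * Real.exp (-(A * σ ^ 2 * Real.exp (2 * C * σ) * spread n k))) := by
          refine urnAvg_mono (by omega) n fun k hk => ?_
          -- The variance proxies of the branches add up to the fraction `1 - spread n k` of the
          -- target; the missing part is the gain handed to the contraction estimate.
          have h1 : ∏ i, treeAvg b (k i) (treeMgf ν c) ≤
              Real.exp (m * ∑ i, l (k i) +
                A * σ ^ 2 * Real.exp (2 * C * σ) * (1 - spread n k)) := by
            calc _ ≤ ∏ i, Real.exp (m * l (k i) +
                  A * σ ^ 2 * Real.exp (2 * C * σ) * ((k i : ℝ) / (n + 1)) ^ 2) := by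
                  refine Finset.prod_le_prod (fun i _ => ?_) fun i _ => ?_
                  · have := treeAvg_mono (k i) (f := 0) (g := treeMgf ν c)
                      fun S _ _ => treeMgf_nonneg ν c S
                    rwa [map_zero] at this
                  · have : k i ≤ n := hk ▸ Finset.single_le_sum (fun _ _ => Nat.zero_le _)
                      (Finset.mem_univ i)
                    refine (ih (k i) (by omega)).trans (Real.exp_le_exp.2 ?_)
                    refine add_le_add_right ?_ _
                    have h2 := scale_le p q hk i
                    have h3 := scale_nonneg p q (k i)
                    have h4 : scale p q (k i) ≤ σ := h2.trans
                      (mul_le_of_le_one_left hσ0 (div_le_one_of_sum_eq hk i))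
                    calc A * scale p q (k i) ^ 2 * Real.exp (2 * C * scale p q (k i))
                        ≤ A * ((k i : ℝ) / (n + 1) * σ) ^ 2 * Real.exp (2 * C * σ) := by gcongr
                      _ = _ := by ring
              _ = _ := by
                  rw [← Real.exp_sum, Finset.sum_add_distrib, ← Finset.mul_sum, ← Finset.mul_sum,
                    spread, sub_sub_cancel]
          refine (mul_le_mul_of_nonneg_left h1 (vecMgf_nonneg _ _)).trans (le_of_eq ?_)
          have h2 : F k = vecMgf ν (fun i => c (k i)) * Real.exp (d k) := by
            simp only [hF, Real.exp_add, integral_mul_const, vecMgf]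
          simp only [Pi.smul_apply, smul_eq_mul]
          have h3 : Real.exp (m * ∑ i, l (k i) +
              A * σ ^ 2 * Real.exp (2 * C * σ) * (1 - spread n k)) = G * (Real.exp (d k) *
              Real.exp (-(A * σ ^ 2 * Real.exp (2 * C * σ) * spread n k))) := by
            rw [hG, ← Real.exp_add, ← Real.exp_add]
            congr 1
            simp only [hd]
            ring
          rw [h2, h3]
          ring
      _ = G * _ := by rw [map_smul, smul_eq_mul]
      _ ≤ G := mul_le_of_le_one_right (Real.exp_pos _).le hmain

/-! ### From the tree law to finite averages -/

lemma toMeasure_bind_eq_sum {α β : Type*} [MeasurableSpace β] (p : PMF α) (q : α → PMF β)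
    {F : Finset α} (hF : ∀ a ∉ F, p a = 0) :
    (p.bind q).toMeasure = ∑ a ∈ F, p a • (q a).toMeasure := by
  ext s hs
  rw [PMF.toMeasure_bind_apply _ _ _ hs, tsum_eq_sum (s := F) fun a ha => by simp [hF a ha]]
  simp [Measure.finsetSum_apply]

lemma integral_toMeasure_bind {α β : Type*} [MeasurableSpace β] (p : PMF α) (q : α → PMF β)
    {F : Finset α} (hF : ∀ a ∉ F, p a = 0) {f : β → ℝ}
    (hf : ∀ a ∈ F, Integrable f (q a).toMeasure) :
    Integrable f (p.bind q).toMeasure ∧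
      ∫ x, f x ∂(p.bind q).toMeasure = ∑ a ∈ F, (p a).toReal * ∫ x, f x ∂(q a).toMeasure := by
  have h : ∀ a ∈ F, Integrable f (p a • (q a).toMeasure) := fun a ha =>
    (hf a ha).smul_measure (p.apply_ne_top a)
  rw [toMeasure_bind_eq_sum p q hF]
  refine ⟨integrable_finsetSum_measure.2 h, ?_⟩
  rw [integral_finsetSum_measure h]
  simp [integral_smul_measure]

lemma integral_toMeasure_map {α β : Type*} [MeasurableSpace β] [MeasurableSingletonClass β]
    (p : PMF α) (g : α → β) {F : Finset α} (hF : ∀ a ∉ F, p a = 0) (f : β → ℝ) :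
    Integrable f (p.map g).toMeasure ∧
      ∫ x, f x ∂(p.map g).toMeasure = ∑ a ∈ F, (p a).toReal * f (g a) := by
  have h := integral_toMeasure_bind p (PMF.pure ∘ g) hF (f := f) (fun a _ => by
    simp only [Function.comp, PMF.toMeasure_pure]
    exact integrable_dirac (by simp))
  rw [PMF.bind_pure_comp] at h
  refine ⟨h.1, h.2.trans ?_⟩
  simp [PMF.toMeasure_pure]

instance (b : ℕ) : DiscreteMeasurableSpace (Tree b) := ⟨fun _ => trivial⟩

lemma external_nonempty (hb : 1 ≤ b) {S : Tree b} (hS : IsTree S) : (external S).Nonempty :=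
  Finset.card_pos.1 (by exact_mod_cast card_external_pos hb hS)

lemma grow_eq (hb : 1 ≤ b) {S : Tree b} (hS : IsTree S) :
    grow S = (PMF.uniformOfFinset (external S) (external_nonempty hb hS)).map
      fun v => insert v S := by
  rw [grow, dif_pos (external_nonempty hb hS)]

lemma integral_grow (hb : 1 ≤ b) {S : Tree b} (hS : IsTree S) (f : Tree b → ℝ) :
    Integrable f (grow S).toMeasure ∧ ∫ T, f T ∂(grow S).toMeasure = growAvg b f S := by
  rw [grow_eq hb hS]
  have h := integral_toMeasure_map (PMF.uniformOfFinset (external S) (external_nonempty hb hS))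
    (fun v => insert v S) (F := external S)
    (fun a ha => PMF.uniformOfFinset_apply_of_notMem _ ha) f
  refine ⟨h.1, h.2.trans ?_⟩
  rw [growAvg_apply, Finset.sum_div]
  refine Finset.sum_congr rfl fun v hv => ?_
  rw [PMF.uniformOfFinset_apply_of_mem _ hv, ENNReal.toReal_inv, ENNReal.toReal_natCast,
    inv_mul_eq_div]

/-- Finite support makes every function of the tree integrable and confines all averages to genuine
trees of size `n`. -/
lemma exists_finset_treeLaw (hb : 1 ≤ b) (n : ℕ) : ∃ F : Finset (Tree b),
    (∀ S ∉ F, treeLaw b n S = 0) ∧ ∀ S ∈ F, IsTree S ∧ S.card = n := by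
  classical
  induction n with
  | zero =>
    refine ⟨{∅}, fun S hS => ?_, ?_⟩
    · rw [treeLaw, PMF.pure_apply, if_neg (by simpa using hS)]
    · simp [isTree_empty]
  | succ n ih =>
    obtain ⟨F, hF, hF'⟩ := ih
    refine ⟨F.biUnion fun S => (external S).image fun v => insert v S, fun T hT => ?_, ?_⟩
    · rw [treeLaw, PMF.bind_apply, ENNReal.tsum_eq_zero]
      intro S
      by_cases hS : S ∈ F
      · rw [grow_eq hb (hF' S hS).1, mul_eq_zero]
        right
        rw [PMF.apply_eq_zero_iff, PMF.mem_support_map_iff]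
        rintro ⟨v, hv, rfl⟩
        refine hT (Finset.mem_biUnion.2 ⟨S, hS, Finset.mem_image.2 ⟨v, ?_, rfl⟩⟩)
        simpa using hv
      · rw [hF S hS, zero_mul]
    · intro T hT
      obtain ⟨S, hS, hT⟩ := Finset.mem_biUnion.1 hT
      obtain ⟨v, hv, rfl⟩ := Finset.mem_image.1 hT
      refine ⟨(hF' S hS).1.insert hv, ?_⟩
      rw [Finset.card_insert_of_notMem (not_mem_of_mem_external hv), (hF' S hS).2]

lemma integral_treeLaw (hb : 1 ≤ b) (n : ℕ) (f : Tree b → ℝ) :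
    Integrable f (treeLaw b n).toMeasure ∧ ∫ S, f S ∂(treeLaw b n).toMeasure = treeAvg b n f := by
  induction n generalizing f with
  | zero =>
    rw [treeLaw, PMF.toMeasure_pure]
    exact ⟨integrable_dirac (by simp), integral_dirac _ _⟩
  | succ n ih =>
    obtain ⟨F, hF, hF'⟩ := exists_finset_treeLaw hb n
    have h := integral_toMeasure_bind (treeLaw b n) grow hF (f := f)
      (fun S hS => (integral_grow hb (hF' S hS).1 f).1)
    rw [treeLaw]
    refine ⟨h.1, h.2.trans ?_⟩
    rw [treeAvg_succ, ← (ih _).2, ← PMF.map_id (treeLaw b n),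
      (integral_toMeasure_map (treeLaw b n) id hF _).2, PMF.map_id]
    exact Finset.sum_congr rfl fun S hS => by rw [(integral_grow hb (hF' S hS).1 f).2, id]

lemma ae_treeLaw (hb : 1 ≤ b) (n : ℕ) :
    ∀ᵐ S ∂(treeLaw b n).toMeasure, IsTree S ∧ S.card = n := by
  obtain ⟨F, hF, hF'⟩ := exists_finset_treeLaw hb n
  rw [ae_iff, PMF.toMeasure_apply_eq_zero_iff _ (MeasurableSet.of_discrete),
    Set.disjoint_left]
  intro S hS h
  refine h (hF' S ?_)
  by_contra hSF
  exact (PMF.mem_support_iff _ _).1 hS (hF S hSF)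

/-! ### Weighted trees and the Chernoff bound -/

section

variable {ν : Measure (Fin b → ℝ)} [IsProbabilityMeasure ν]

instance (n : ℕ) : IsProbabilityMeasure (weightedTreeLaw b n ν) := by
  unfold weightedTreeLaw; infer_instance

lemma integral_weightedTreeLaw (hb : 1 ≤ b) (n : ℕ) {f : Tree b × Weights b → ℝ}
    (hm : ∀ S, Measurable fun z => f (S, z))
    (hf : ∀ S, Integrable (fun z => f (S, z)) (Measure.infinitePi fun _ : Node b => ν)) :
    Integrable f (weightedTreeLaw b n ν) ∧ ∫ x, f x ∂(weightedTreeLaw b n ν) =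
      treeAvg b n fun S => ∫ z, f (S, z) ∂(Measure.infinitePi fun _ : Node b => ν) := by
  have hmeas : Measurable f := measurable_from_prod_countable_right hm
  have hi : Integrable f (weightedTreeLaw b n ν) := by
    rw [weightedTreeLaw, integrable_prod_iff hmeas.aestronglyMeasurable]
    exact ⟨ae_of_all _ hf, (integral_treeLaw hb n _).1⟩
  refine ⟨hi, ?_⟩
  rw [weightedTreeLaw] at hi ⊢
  rw [integral_prod _ hi, (integral_treeLaw hb n _).2]

lemma measurable_wtoll (c : ℕ → ℝ) (S : Tree b) : Measurable fun z => wtoll c (S, z) := by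
  simp only [wtoll]
  fun_prop

lemma integral_weights (f : (Fin b → ℝ) → ℝ) (hf : AEStronglyMeasurable f ν) (u : Node b) :
    ∫ z, f (z u) ∂(Measure.infinitePi fun _ : Node b => ν) = ∫ z, f z ∂ν := by
  have h := (measurePreserving_eval_infinitePi (fun _ : Node b => ν) u).map_eq
  rw [← h] at hf
  conv_rhs => rw [← h]
  rw [integral_map (measurable_pi_apply u).aemeasurable hf]

lemma integrable_weights {f : (Fin b → ℝ) → ℝ} (hf : Integrable f ν) (u : Node b) :
    Integrable (fun z : Weights b => f (z u)) (Measure.infinitePi fun _ : Node b => ν) :=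
  (measurePreserving_eval_infinitePi (fun _ : Node b => ν) u).integrable_comp_of_integrable hf

variable {m M : ℝ}

lemma integral_wtoll (hz : ∀ᵐ z ∂ν, ∀ i, 0 ≤ z i ∧ z i ≤ M) (hm : ∀ i, ∫ z, z i ∂ν = m)
    (c : ℕ → ℝ) (S : Tree b) :
    Integrable (fun z => wtoll c (S, z)) (Measure.infinitePi fun _ : Node b => ν) ∧
      ∫ z, wtoll c (S, z) ∂(Measure.infinitePi fun _ : Node b => ν) = m * toll c S := by
  have hi : ∀ u ∈ S, ∀ i ∈ Finset.univ, Integrable (fun z : Weights b =>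
      z u i * c (size S (u ++ [i]))) (Measure.infinitePi fun _ : Node b => ν) := fun u _ i _ =>
    (integrable_weights (integrable_apply_of_bounded hz i) u).mul_const _
  unfold wtoll
  refine ⟨integrable_finsetSum _ fun u hu => integrable_finsetSum _ (hi u hu), ?_⟩
  rw [integral_finsetSum _ fun u hu => integrable_finsetSum _ (hi u hu), toll, Finset.mul_sum]
  refine Finset.sum_congr rfl fun u hu => ?_
  rw [integral_finsetSum _ (hi u hu), Finset.mul_sum]
  refine Finset.sum_congr rfl fun i _ => ?_
  rw [integral_mul_const, integral_weights (fun z => z i)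
    (measurable_pi_apply i).aestronglyMeasurable, hm]

lemma integral_exp_wtoll (hz : ∀ᵐ z ∂ν, ∀ i, 0 ≤ z i ∧ z i ≤ M) (c : ℕ → ℝ) (S : Tree b) :
    Integrable (fun z => Real.exp (wtoll c (S, z))) (Measure.infinitePi fun _ : Node b => ν) ∧
      ∫ z, Real.exp (wtoll c (S, z)) ∂(Measure.infinitePi fun _ : Node b => ν) =
        treeMgf ν c S := by
  set X : Node b → (Fin b → ℝ) → ℝ := fun u z => ∑ i, z i * c (size S (u ++ [i])) with hX
  have hXm : ∀ u, Measurable (X u) := fun u => by simp only [hX]; fun_prop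
  have hXb : ∀ u, ∀ᵐ z ∂ν, |X u z| ≤ ∑ i, M * |c (size S (u ++ [i]))| := by
    intro u
    filter_upwards [hz] with z hz
    refine (Finset.abs_sum_le_sum_abs _ _).trans (Finset.sum_le_sum fun i _ => ?_)
    rw [abs_mul, abs_of_nonneg (hz i).1]
    exact mul_le_mul_of_nonneg_right (hz i).2 (abs_nonneg _)
  have hind := iIndepFun_infinitePi (P := fun _ : Node b => ν) (X := X) hXm
  have hm := hind.mgf_sum (fun u => (hXm u).comp (measurable_pi_apply u)) S (t := 1)
  have hint := hind.integrable_exp_mul_sum (t := 1)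
    (fun u => (hXm u).comp (measurable_pi_apply u)) (s := S) (fun u _ => by
      simp only [one_mul]
      exact integrable_weights (f := fun z => Real.exp (X u z))
        (integrable_exp_of_abs_le (hXm u) (hXb u)) u)
  simp only [mgf, one_mul, Finset.sum_apply] at hm hint
  refine ⟨hint, hm.trans (Finset.prod_congr rfl fun u _ => ?_)⟩
  exact integral_weights (fun z => Real.exp (X u z)) (hXm u).exp.aestronglyMeasurable u

lemma ae_weightedTreeLaw (hb : 1 ≤ b) (n : ℕ) :
    ∀ᵐ x ∂(weightedTreeLaw b n ν), IsTree x.1 ∧ x.1.card = n :=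
  Measure.quasiMeasurePreserving_fst.ae (ae_treeLaw hb n)

lemma scale_mul (s p q : ℝ) (n : ℕ) :
    scale (s * p) (s * q) n = |s| * scale p q n := by
  simp only [scale, abs_mul]
  ring

lemma wtoll_mul (s p q : ℝ) (x : Tree b × Weights b) :
    wtoll (quad (s * p) (s * q)) x = s * wtoll (quad p q) x := by
  simp only [wtoll, quad, Finset.mul_sum]
  exact Finset.sum_congr rfl fun u _ => Finset.sum_congr rfl fun i _ => by ring

lemma integral_eq_of_ae_eq_wtoll (hb : 1 ≤ b) (hz : ∀ᵐ z ∂ν, ∀ i, 0 ≤ z i ∧ z i ≤ M)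
    (hm : ∀ i, ∫ z, z i ∂ν = m) {c : ℕ → ℝ} {n : ℕ} {X : Tree b × Weights b → ℝ}
    (hX : X =ᵐ[weightedTreeLaw b n ν] wtoll c) :
    Integrable X (weightedTreeLaw b n ν) ∧
      ∫ x, X x ∂(weightedTreeLaw b n ν) = m * meanToll b c n := by
  have h := integral_weightedTreeLaw hb n (f := wtoll c) (measurable_wtoll c)
    (fun S => (integral_wtoll hz hm c S).1)
  refine ⟨h.1.congr hX.symm, ?_⟩
  rw [integral_congr_ae hX, h.2]
  simp only [(integral_wtoll hz hm c _).2]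
  exact (treeAvg b n).map_smul m (toll c)

/-- Exponential tail bound for the weighted tolls that are quadratic in the size. -/
theorem exists_tail_le (hb : 2 ≤ b) (hz : ∀ᵐ z ∂ν, ∀ i, 0 ≤ z i ∧ z i ≤ M)
    (hm : ∀ i, ∫ z, z i ∂ν = m) :
    ∃ A C : ℝ, 0 < A ∧ 0 < C ∧ ∀ (p q : ℝ) (n : ℕ) (X : Tree b × Weights b → ℝ),
      X =ᵐ[weightedTreeLaw b n ν] wtoll (quad p q) → ∀ s a : ℝ, 0 ≤ s →
      (weightedTreeLaw b n ν).real
          {x | a < |X x - ∫ y, X y ∂(weightedTreeLaw b n ν)|} ≤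
        2 * Real.exp (-(s * a) +
          A * (s * scale p q n) ^ 2 * Real.exp (2 * C * (s * scale p q n))) := by
  obtain ⟨A, C, hA, hC, h⟩ := exists_treeAvg_treeMgf_le hb ν hz hm
  refine ⟨A, C, hA, hC, fun p q n X hX s a hs => ?_⟩
  -- The parameter `r` is absorbed into the coefficients of the toll, which multiplies its scale by
  -- `|r|`; the values `s` and `-s` thus share the same error term.
  have hmgf : ∀ r : ℝ, |r| = s → Integrable (fun x => Real.exp (r * X x)) (weightedTreeLaw b n ν) ∧
      mgf X (weightedTreeLaw b n ν) r ≤ Real.exp (r * (m * meanToll b (quad p q) n) +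
        A * (s * scale p q n) ^ 2 * Real.exp (2 * C * (s * scale p q n))) := by
    intro r hr
    have hae : (fun x => Real.exp (r * X x)) =ᵐ[weightedTreeLaw b n ν]
        fun x => Real.exp (wtoll (quad (r * p) (r * q)) x) := by
      filter_upwards [hX] with x hx
      rw [hx, wtoll_mul]
    have h1 := integral_weightedTreeLaw (ν := ν) (by omega) n
      (f := fun x => Real.exp (wtoll (quad (r * p) (r * q)) x))
      (fun S => (measurable_wtoll _ S).exp) (fun S => (integral_exp_wtoll hz _ S).1)
    refine ⟨h1.1.congr hae.symm, ?_⟩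
    rw [mgf, integral_congr_ae hae, h1.2]
    simp only [(integral_exp_wtoll hz _ _).2]
    refine (h (r * p) (r * q) n).trans (le_of_eq ?_)
    rw [scale_mul, hr, meanToll_quad, meanToll_quad]
    ring_nf
  rw [(integral_eq_of_ae_eq_wtoll (by omega) hz hm hX).2]
  set e := m * meanToll b (quad p q) n
  set B := A * (s * scale p q n) ^ 2 * Real.exp (2 * C * (s * scale p q n))
  obtain ⟨i1, g1⟩ := hmgf s (abs_of_nonneg hs)
  obtain ⟨i2, g2⟩ := hmgf (-s) (by rw [abs_neg, abs_of_nonneg hs])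
  have t1 : (weightedTreeLaw b n ν).real {x | e + a ≤ X x} ≤ Real.exp (-(s * a) + B) := by
    refine (measure_ge_le_exp_mul_mgf _ hs i1).trans
      ((mul_le_mul_of_nonneg_left g1 (Real.exp_pos _).le).trans (le_of_eq ?_))
    rw [← Real.exp_add]
    ring_nf
  have t2 : (weightedTreeLaw b n ν).real {x | X x ≤ e - a} ≤ Real.exp (-(s * a) + B) := by
    refine (measure_le_le_exp_mul_mgf _ (neg_nonpos.2 hs) i2).trans
      ((mul_le_mul_of_nonneg_left g2 (Real.exp_pos _).le).trans (le_of_eq ?_))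
    rw [← Real.exp_add]
    ring_nf
  have hsub : {x | a < |X x - e|} ⊆ {x | e + a ≤ X x} ∪ {x | X x ≤ e - a} := by
    intro x hx
    rcases lt_abs.1 (show a < |X x - e| from hx) with h | h
    · exact Or.inl (show e + a ≤ X x by linarith)
    · exact Or.inr (show X x ≤ e - a by linarith)
  calc _ ≤ (weightedTreeLaw b n ν).real ({x | e + a ≤ X x} ∪ {x | X x ≤ e - a}) :=
        measureReal_mono hsub
    _ ≤ _ := measureReal_union_le _ _
    _ ≤ _ := by linarith

lemma pathLength_ae_eq (hb : 1 ≤ b) (n : ℕ) :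
    pathLength =ᵐ[weightedTreeLaw b n ν] wtoll (quad 1 0) := by
  filter_upwards [ae_weightedTreeLaw hb n] with x hx
  rw [show x = (x.1, x.2) from rfl, pathLength_eq_wtoll hx.1]
  congr 1
  ext k
  simp [quad]

lemma wienerIndex_ae_eq (hb : 1 ≤ b) (n : ℕ) :
    wienerIndex =ᵐ[weightedTreeLaw b n ν] wtoll (quad n (-1)) := by
  filter_upwards [ae_weightedTreeLaw hb n] with x hx
  rw [show x = (x.1, x.2) from rfl, wienerIndex_eq_wtoll hx.1, hx.2]
  congr 1
  ext k
  simp only [quad]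
  ring

end

/-! ### Choice of the Chernoff parameter -/

lemma tendsto_log_natCast : Tendsto (fun n : ℕ => Real.log n) atTop atTop :=
  Real.tendsto_log_atTop.comp tendsto_natCast_atTop_atTop

/-- Comparison of the optimized Chernoff exponent with the claimed rate. -/
lemma eventually_two_mul_exp_le {A C κ t : ℝ} (hC : 0 < C) (hκ : 0 < κ) (ht : 0 < t) (r : ℝ) :
    ∀ᶠ L : ℝ in atTop, 2 * Real.exp (-(Real.log L / (4 * C) * (t * (κ * L))) +
      A * (Real.log L / (4 * C)) ^ 2 * Real.exp (2 * C * (Real.log L / (4 * C)))) ≤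
      Real.exp (-(κ / (8 * C) * t * L * (Real.log L + r))) := by
  have h1 : ∀ᶠ L : ℝ in atTop, |A / (4 * C) ^ 2 * (Real.log L) ^ (2 : ℝ)| ≤ L ^ (1 / 2 : ℝ) / 2 := by
    have h := ((isLittleO_log_rpow_rpow_atTop 2 (by norm_num : (0 : ℝ) < 1 / 2)).const_mul_left
      (A / (4 * C) ^ 2)).bound (by norm_num : (0 : ℝ) < 1 / 2)
    filter_upwards [h, eventually_gt_atTop 0] with L hL hL0
    rw [Real.norm_eq_abs, Real.norm_of_nonneg (by positivity)] at hL
    linarith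
  have h2 : ∀ᶠ L : ℝ in atTop, 1 / (κ / (8 * C) * t) + r ≤ Real.log L :=
    Real.tendsto_log_atTop.eventually_ge_atTop _
  filter_upwards [h1, h2, eventually_ge_atTop 2] with L h1 h2 hL
  have hL0 : 0 < L := by linarith
  set θ := κ / (8 * C) * t with hθ
  have hθ0 : 0 < θ := by positivity
  -- The denominator `4 * C` is chosen for this: the error becomes `(log L) ^ 2 * L ^ (1 / 2)` up to
  -- a constant, hence `o(L)`.
  have e1 : Real.exp (2 * C * (Real.log L / (4 * C))) = L ^ (1 / 2 : ℝ) := by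
    rw [Real.rpow_def_of_pos hL0]
    congr 1
    field_simp
    ring
  have e2 : A * (Real.log L / (4 * C)) ^ 2 * L ^ (1 / 2 : ℝ) ≤ L / 2 := by
    have e3 : A * (Real.log L / (4 * C)) ^ 2 = A / (4 * C) ^ 2 * (Real.log L) ^ (2 : ℝ) := by
      rw [Real.rpow_two]
      field_simp
    have e4 : L ^ (1 / 2 : ℝ) * L ^ (1 / 2 : ℝ) = L := by
      rw [← Real.rpow_add hL0]; norm_num
    rw [e3]
    calc _ ≤ L ^ (1 / 2 : ℝ) / 2 * L ^ (1 / 2 : ℝ) := by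
          gcongr
          exact (le_abs_self _).trans h1
      _ = L / 2 := by rw [div_mul_eq_mul_div, e4]
  -- The main term is twice the claimed one; the surplus exceeds `θ * L * r + L`, which covers `r`,
  -- the error and the factor 2.
  have e5 : Real.log L / (4 * C) * (t * (κ * L)) = 2 * θ * L * Real.log L := by
    rw [hθ]; field_simp; ring
  have e6 : L ≤ θ * L * (Real.log L - r) := by
    have : 1 ≤ θ * (Real.log L - r) := by
      have := mul_le_mul_of_nonneg_left h2 hθ0.le
      rw [mul_add, mul_one_div_cancel hθ0.ne'] at this
      linarith
    nlinarith
  have e7 : (2 : ℝ) ≤ Real.exp 1 := by linarith [Real.add_one_le_exp (1 : ℝ)]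
  rw [e1, e5]
  calc _ ≤ Real.exp 1 * Real.exp (-(2 * θ * L * Real.log L) + L / 2) := by gcongr
    _ = Real.exp (1 + (-(2 * θ * L * Real.log L) + L / 2)) := (Real.exp_add _ _).symm
    _ ≤ _ := by
        apply Real.exp_le_exp.2
        linarith

/-- Half of the leading order is given away, which leaves room for any linear term. -/
lemma eventually_le_meanToll_id (hb : 2 ≤ b) (K' : ℝ) : ∀ᶠ n : ℕ in atTop,
    n * Real.log n / 2 + K' * n ≤ meanToll b (fun k => (k : ℝ)) n := by
  have hb' : (2 : ℝ) ≤ b := by exact_mod_cast hb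
  obtain ⟨K, -, hK⟩ := exists_abs_meanToll_id_sub_le hb
  filter_upwards [tendsto_log_natCast.eventually_ge_atTop (2 * (K + K')),
    eventually_ge_atTop 1] with n hn hn1
  have hn0 : (0 : ℝ) ≤ n * Real.log n := mul_nonneg n.cast_nonneg (Real.log_natCast_nonneg n)
  have h1 := (abs_le.1 (hK n)).1
  have h2 : 1 ≤ (b : ℝ) / (b - 1) := by
    rw [one_le_div (by linarith)]; linarith
  have h3 : n * Real.log n ≤ (b : ℝ) / (b - 1) * (n * Real.log n) :=
    le_mul_of_one_le_left hn0 h2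
  have h4 := mul_le_mul_of_nonneg_left hn (n.cast_nonneg (α := ℝ))
  linarith

section

variable {ν : Measure (Fin b → ℝ)} [IsProbabilityMeasure ν]

/-- Tail bound at the optimal parameter, for functionals whose mean is large compared to their
scale. -/
lemma eventually_tail_le {A C κ t : ℝ} (hC : 0 < C) (hκ : 0 < κ) (ht : 0 < t) (r : ℝ)
    {X : Tree b × Weights b → ℝ} {p q : ℕ → ℝ}
    (htail : ∀ n, ∀ s a : ℝ, 0 ≤ s → (weightedTreeLaw b n ν).real
          {x | a < |X x - ∫ y, X y ∂(weightedTreeLaw b n ν)|} ≤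
        2 * Real.exp (-(s * a) +
          A * (s * scale (p n) (q n) n) ^ 2 * Real.exp (2 * C * (s * scale (p n) (q n) n))))
    (hscale : ∀ᶠ n in atTop, 0 < scale (p n) (q n) n)
    (hmean : ∀ᶠ n : ℕ in atTop, κ * Real.log n * scale (p n) (q n) n ≤
      ∫ y, X y ∂(weightedTreeLaw b n ν)) :
    ∀ᶠ n : ℕ in atTop, (weightedTreeLaw b n ν).real
        {x | t * (∫ y, X y ∂(weightedTreeLaw b n ν)) <
          |X x - ∫ y, X y ∂(weightedTreeLaw b n ν)|} ≤
      Real.exp (-(κ / (8 * C) * t * Real.log n * (Real.log (Real.log n) + r))) := by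
  filter_upwards [hscale, hmean, tendsto_log_natCast.eventually
    (eventually_two_mul_exp_le (A := A) hC hκ ht r),
    tendsto_log_natCast.eventually_ge_atTop 1] with n hσ hn hexp hlog
  set σ := scale (p n) (q n) n
  set E := ∫ y, X y ∂(weightedTreeLaw b n ν)
  set v := Real.log (Real.log n) / (4 * C) with hv
  have hv0 : 0 ≤ v := div_nonneg (Real.log_nonneg hlog) (by positivity)
  have h1 := htail n (v / σ) (t * E) (by positivity)
  rw [div_mul_cancel₀ _ hσ.ne'] at h1
  refine h1.trans (le_trans ?_ hexp)
  have h2 : v * (t * (κ * Real.log n)) ≤ v / σ * (t * E) := by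
    calc v * (t * (κ * Real.log n)) = v / σ * (t * (κ * Real.log n * σ)) := by field_simp
      _ ≤ _ := by gcongr
  gcongr

end

end RecTree

/-! ### The deviation bounds -/

theorem corollary3
    (b : ℕ) (hb : 2 ≤ b)
    -- the law of the random vector `Z`
    (ν : Measure (Fin b → ℝ)) [IsProbabilityMeasure ν]
    (hnonneg : ∀ᵐ z ∂ν, ∀ i, 0 ≤ z i)
    (hident : ∀ i j, IdentDistrib (fun z : Fin b → ℝ => z i) (fun z => z j) ν ν)
    (hbdd : ∃ M : ℝ, ∀ᵐ z ∂ν, √(∑ i, z i ^ 2) ≤ M)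
    (m : ℝ) (hm : m = ∫ z, z ⟨0, by omega⟩ ∂ν) :
    (∀ n : ℕ, Integrable RecTree.pathLength (RecTree.weightedTreeLaw b n ν) ∧
      Integrable RecTree.wienerIndex (RecTree.weightedTreeLaw b n ν)) ∧
    ∃ D : ℝ, 0 < D ∧ ∀ α : ℝ, α = Real.log (b * m / (4 * D * (b - 1) * Real.exp 1)) →
      ∀ t : ℝ, 0 < t →
        (∃ ε : ℕ → ℝ, Tendsto ε atTop (𝓝 0) ∧ ∀ᶠ n : ℕ in atTop,
          (RecTree.weightedTreeLaw b n ν).real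
            {x | t * (∫ y, RecTree.pathLength y ∂(RecTree.weightedTreeLaw b n ν)) <
              |RecTree.pathLength x -
                ∫ y, RecTree.pathLength y ∂(RecTree.weightedTreeLaw b n ν)|} ≤
          Real.exp (-((b / (b - 1)) * (m / D) * t * Real.log n *
            (Real.log (Real.log n) + Real.log t + α + ε n)))) ∧
        (∃ ε : ℕ → ℝ, Tendsto ε atTop (𝓝 0) ∧ ∀ᶠ n : ℕ in atTop,
          (RecTree.weightedTreeLaw b n ν).real
            {x | t * (∫ y, RecTree.wienerIndex y ∂(RecTree.weightedTreeLaw b n ν)) <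
              |RecTree.wienerIndex x -
                ∫ y, RecTree.wienerIndex y ∂(RecTree.weightedTreeLaw b n ν)|} ≤
          Real.exp (-((b / (b - 1)) * (m / D) * t * Real.log n *
            (Real.log (Real.log n) + Real.log t + α + ε n)))) := by
  have hb1 : 1 ≤ b := by omega
  have hb' : (2 : ℝ) ≤ b := by exact_mod_cast hb
  obtain ⟨M, hM⟩ := hbdd
  have hz : ∀ᵐ z ∂ν, ∀ i, 0 ≤ z i ∧ z i ≤ M := by
    filter_upwards [hnonneg, hM] with z h0 hM i
    refine ⟨h0 i, le_trans (Real.le_sqrt_of_sq_le ?_) hM⟩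
    exact Finset.single_le_sum (f := fun i => z i ^ 2) (fun _ _ => sq_nonneg _) (Finset.mem_univ i)
  have hmi : ∀ i, ∫ z, z i ∂ν = m := fun i => by rw [hm]; exact (hident _ _).integral_eq
  have hP := fun n => RecTree.integral_eq_of_ae_eq_wtoll hb1 hz hmi
    (RecTree.pathLength_ae_eq (ν := ν) hb1 n)
  have hW := fun n => RecTree.integral_eq_of_ae_eq_wtoll hb1 hz hmi
    (RecTree.wienerIndex_ae_eq (ν := ν) hb1 n)
  refine ⟨fun n => ⟨(hP n).1, (hW n).1⟩, ?_⟩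
  have hm0 : 0 ≤ m := by
    rw [hm]
    exact integral_nonneg_of_ae (by filter_upwards [hz] with z h using (h _).1)
  rcases hm0.eq_or_lt with rfl | hmpos
  -- With mean weight zero the exponent vanishes and the bounds only say that probabilities are at
  -- most one.
  · refine ⟨1, one_pos, fun α _ t _ => ⟨⟨fun _ => 0, tendsto_const_nhds, ?_⟩,
      ⟨fun _ => 0, tendsto_const_nhds, ?_⟩⟩⟩ <;>
    · refine Eventually.of_forall fun n => ?_
      simp
  obtain ⟨A, C, hA, hC, htail⟩ := RecTree.exists_tail_le hb hz hmi
  have hb1pos : (0 : ℝ) < b - 1 := by linarith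
  -- `D` makes the claimed rate equal to `κ / (8 * C)` with `κ = m / 4`, a value of `κ` that serves
  -- both functionals.
  refine ⟨b / (b - 1) * m * (8 * C) / (m / 4), by positivity, fun α _ t ht => ?_⟩
  set D := b / (b - 1) * m * (8 * C) / (m / 4) with hD
  have hrate : b / (b - 1) * (m / D) = m / 4 / (8 * C) := by
    rw [hD]; field_simp
  have hκ : 0 < m / 4 := by positivity
  refine ⟨⟨fun _ => 0, tendsto_const_nhds, ?_⟩, ⟨fun _ => 0, tendsto_const_nhds, ?_⟩⟩
  · have h := RecTree.eventually_tail_le (ν := ν) hC hκ ht (Real.log t + α)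
      (fun n => htail 1 0 n _ (RecTree.pathLength_ae_eq hb1 n))
      (by
        filter_upwards [eventually_gt_atTop 0] with n hn
        have : (0 : ℝ) < n := by exact_mod_cast hn
        simpa [RecTree.scale] using hn)
      (by
        filter_upwards [RecTree.eventually_le_meanToll_id hb 0] with n hn
        rw [(hP n).2, RecTree.meanToll_quad]
        have h1 : (0 : ℝ) ≤ n * Real.log n :=
          mul_nonneg n.cast_nonneg (Real.log_natCast_nonneg n)
        have h2 : RecTree.scale 1 0 n = n := by simp [RecTree.scale]
        rw [h2]
        nlinarith)
    filter_upwards [h] with n hn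
    refine hn.trans (le_of_eq ?_)
    rw [hrate]
    ring_nf
  · have h := RecTree.eventually_tail_le (ν := ν) hC hκ ht (Real.log t + α)
      (fun n => htail n (-1) n _ (RecTree.wienerIndex_ae_eq hb1 n))
      (by
        filter_upwards [eventually_gt_atTop 0] with n hn
        have : (0 : ℝ) < n := by exact_mod_cast hn
        simp only [RecTree.scale]
        positivity)
      (by
        -- The surplus `4 * b * n`, multiplied by `n`, pays for the negative quadratic part of the
        -- toll. The scale is `2 * n ^ 2`, which turns the factor `m / 2` into `m / 4`.
        filter_upwards [RecTree.eventually_le_meanToll_id hb (4 * b)] with n hn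
        rw [(hW n).2, RecTree.meanToll_quad]
        have h1 := RecTree.meanToll_sq_le hb n
        have h2 : RecTree.scale n (-1) n = 2 * (n : ℝ) ^ 2 := by
          simp [RecTree.scale]; ring
        have h3 := mul_le_mul_of_nonneg_left hn (n.cast_nonneg (α := ℝ))
        have h4 : (n : ℝ) ^ 2 * Real.log n / 2 ≤
            n * RecTree.meanToll b (fun k => (k : ℝ)) n +
              -1 * RecTree.meanToll b (fun k => (k : ℝ) ^ 2) n := by linarith
        rw [h2]
        have h5 := mul_le_mul_of_nonneg_left h4 hm0
        linarith)
    filter_upwards [h] with n hn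
    refine hn.trans (le_of_eq ?_)
    rw [hrate]
    ring_nf
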